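/- Let $K$ be a field and let $K_0(\mathcal V_K)$ be the Grothendieck ring of varieties over $K$: the abelian group generated by isomorphism classes $[X]$ of varieties over $K$ (separated $K$-schemes of finite type) modulo the relations $[X]=[Y]+[X\smallsetminus Y]$ for $Y\subset X$ closed, with the product $[X]\cdot[Y]=[X\times_K Y]$. Let $\mathbb L=[\mathbb A^1]$ and $\mathbb S=[\mathbb P^1\smallsetminus\{0,1,\infty\}]$ (where $\mathbb P^1\smallsetminus\{0,1,\infty\}$ is, as is well known, the moduli space $\mathcal M_{0,4}$). A *melonic construction* is a finite list $T=(t_1,\dots,t_n)$, $n\ge 0$, of tuples $t_s=(b_s,p_s,k_s)$ such that: (i) $b_s=(a_1,\dots,a_{r_s})$ is a tuple of $r_s\ge1$ positive integers; (ii) $0\le p_s<s$; (iii) $1\le k_s\le |b_{p_s}|$, where $|b|$ is the length of $b$ and $b_0=(1)$; (iv) $p_s>0$ for $s>1$; (v) for all $i\ge 1$ with $b_i=(a_1,\dots,a_{r_i})$ and all $1\le j\le r_i$, at most $a_j$ of the tuples $t_s$ have $p_s=i$, $k_s=j$. It determines a graph up to isomorphism: start from a graph with two vertices joined by a single edge (stage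 $0$, considered as its own first banana), and at stage $s=1,\dots,n$ take an edge of the $k_s$-th banana built at stage $p_s$ that has not been replaced yet, and replace it by a string of $r_s$ bananas joining its endpoints, with $a_1,\dots,a_{r_s}$ parallel edges respectively. (Edges are implicitly directed, so that the order of the bananas makes sense.) A *melonic graph* is a graph obtained in this way. For a finite graph $G$ with $n$ edges let $\Psi_G(t)=\sum_{\tau}\prod_{e\notin \tau}t_e$, the sum over all the spanning trees $\tau$ of $G$, be its Kirchhoff–Symanzik polynomial, and let $$\mathbb U(G)=[\mathbb A^n\smallsetminus\{\Psi_G=0\}]\in K_0(\mathcal V_K)$$ be the class of the complement of the affine graph hypersurface. Then $\mathbb S=\mathbb L-2$, and for every melonic graph $G$ there is a polynomial $P(t)=a_mt^m+\cdots+a_1t+a_0\in\mathbb Z[t]$ with nonnegative integer coefficients such that $\mathbb U(G)=P(\mathbb S)$. -/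

import Mathlib

open CategoryTheory AlgebraicGeometry

universe u

/-! ## The Grothendieck ring of varieties -/

/-- A variety over the field `K`: a separated scheme of finite type over `Spec K`. -/
structure KVariety (K : Type u) [Field K] where
  /-- the underlying scheme -/
  scheme : Scheme.{u}
  /-- the structure morphism -/
  str : scheme ⟶ Spec (CommRingCat.of K)
  locallyOfFiniteType : LocallyOfFiniteType str
  quasiCompact : QuasiCompact str
  isSeparated : IsSeparated str

attribute [local instance] MvPolynomial.gradedAlgebra

namespace KVariety

variable {K : Type u} [Field K]

/-- An open subscheme of a variety is a variety. -/
noncomputable def openSubvariety (X : KVariety K) (U : X.scheme.Opens) : KVariety K where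
  scheme := U
  str := U.ι ≫ X.str
  locallyOfFiniteType := by
    have := X.locallyOfFiniteType
    infer_instance
  quasiCompact := by
    have := X.locallyOfFiniteType
    have := X.quasiCompact
    have : IsLocallyNoetherian X.scheme := LocallyOfFiniteType.isLocallyNoetherian X.str
    infer_instance
  isSeparated := by
    have := X.isSeparated
    infer_instance

variable (K) in
/-- Affine space over `K` with coordinates indexed by the finite type `ι`. -/
noncomputable def affineSpace (ι : Type) [Finite ι] : KVariety K where
  scheme := Spec (CommRingCat.of (MvPolynomial ι K))
  str := Spec.map (CommRingCat.ofHom (algebraMap K (MvPolynomial ι K)))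
  locallyOfFiniteType := by
    rw [HasRingHomProperty.Spec_iff (P := @LocallyOfFiniteType)]
    exact (RingHom.finiteType_algebraMap).2 inferInstance
  quasiCompact := inferInstance
  isSeparated := inferInstance

/-- The complement of the hypersurface `F = 0` in affine space. -/
noncomputable def hypersurfaceComplement {ι : Type} [Finite ι] (F : MvPolynomial ι K) :
    KVariety K :=
  (affineSpace K ι).openSubvariety (PrimeSpectrum.basicOpen F)

variable (K) in
theorem finiteType_zero :
    Algebra.FiniteType (MvPolynomial.homogeneousSubmodule (Fin 2) K 0)
      (MvPolynomial (Fin 2) K) :=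
  have : IsScalarTower K (MvPolynomial.homogeneousSubmodule (Fin 2) K 0)
      (MvPolynomial (Fin 2) K) := ⟨fun a x y => smul_mul_assoc a x.1 y⟩
  Algebra.FiniteType.of_restrictScalars_finiteType K _ _

variable (K) in
theorem isClosedImmersion_zero :
    IsClosedImmersion (Spec.map (CommRingCat.ofHom
      (algebraMap K (MvPolynomial.homogeneousSubmodule (Fin 2) K 0)))) := by
  refine IsClosedImmersion.spec_of_surjective _ fun x => ?_
  obtain ⟨x, hx⟩ := x
  obtain ⟨c, rfl⟩ : ∃ c : K, MvPolynomial.C c = x :=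
    ⟨_, (MvPolynomial.totalDegree_eq_zero_iff_eq_C.1
      (MvPolynomial.totalDegree_zero_iff_isHomogeneous _ |>.2 hx)).symm⟩
  exact ⟨c, rfl⟩

variable (K) in
/-- The projective line `Proj K[X₀, X₁]`. -/
noncomputable def projectiveLine : KVariety K where
  scheme := Proj (MvPolynomial.homogeneousSubmodule (Fin 2) K)
  str := Proj.toSpecZero (MvPolynomial.homogeneousSubmodule (Fin 2) K) ≫
    Spec.map (CommRingCat.ofHom
      (algebraMap K (MvPolynomial.homogeneousSubmodule (Fin 2) K 0)))
  locallyOfFiniteType := by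
    have := finiteType_zero K
    have := isClosedImmersion_zero K
    infer_instance
  quasiCompact := by
    have := finiteType_zero K
    have := isClosedImmersion_zero K
    infer_instance
  isSeparated := by
    have := isClosedImmersion_zero K
    infer_instance

variable (K) in
/-- `ℙ¹ ∖ {0, 1, ∞}`: the complement of the zero locus of `X₀ X₁ (X₀ - X₁)`, that is, of the
three rational points `[0 : 1]`, `[1 : 1]`, `[1 : 0]`. -/
noncomputable def projectiveLineMinusThreePoints : KVariety K :=
  (projectiveLine K).openSubvariety
    (Proj.basicOpen (MvPolynomial.homogeneousSubmodule (Fin 2) K)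
      (MvPolynomial.X 0 * MvPolynomial.X 1 * (MvPolynomial.X 0 - MvPolynomial.X 1)))

end KVariety

/-- The relations of the Grothendieck ring of varieties among the free commutative generators
`[X]`, for `X` a variety over `K`. -/
inductive GrothendieckRel (K : Type u) [Field K] :
    FreeCommRing (KVariety K) → FreeCommRing (KVariety K) → Prop
  /-- `[X] = [Y]` if `X` and `Y` are isomorphic over `K`. -/
  | iso (X Y : KVariety K) (φ : X.scheme ≅ Y.scheme) (hφ : φ.hom ≫ Y.str = X.str) :
      GrothendieckRel K (FreeCommRing.of X) (FreeCommRing.of Y)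
  /-- `[X] = [Y] + [X ∖ Y]` if `Y` is a closed subvariety of `X`; here `i` is the inclusion of
  `Y` and `j` the inclusion of the open complement `U` of `Y`. -/
  | scissor (X Y U : KVariety K) (i : Y.scheme ⟶ X.scheme) (j : U.scheme ⟶ X.scheme)
      (hi : IsClosedImmersion i) (hj : IsOpenImmersion j)
      (hiK : i ≫ X.str = Y.str) (hjK : j ≫ X.str = U.str)
      (hij : Set.range j = (Set.range i)ᶜ) :
      GrothendieckRel K (FreeCommRing.of X) (FreeCommRing.of Y + FreeCommRing.of U)
  /-- `[Z] = [X] · [Y]` if `Z` is the product of `X` and `Y` over `K`, with projections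
  `p` and `q`. -/
  | prod (X Y Z : KVariety K) (p : Z.scheme ⟶ X.scheme) (q : Z.scheme ⟶ Y.scheme)
      (hp : p ≫ X.str = Z.str) (hZ : IsPullback p q X.str Y.str) :
      GrothendieckRel K (FreeCommRing.of Z) (FreeCommRing.of X * FreeCommRing.of Y)
  /-- `[Spec K] = 1`. -/
  | point (X : KVariety K) (hX : IsIso X.str) :
      GrothendieckRel K (FreeCommRing.of X) 1

/-- The Grothendieck ring `K₀(𝒱_K)` of varieties over `K`, by generators and relations. Since the
relations `[Z] = [X] · [Y]` and `[Spec K] = 1` just rewrite products of generators as generators,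
this is the abelian group generated by isomorphism classes of varieties modulo the relations
`[X] = [Y] + [X ∖ Y]`, with multiplication induced by the product of varieties. -/
abbrev GrothendieckRing (K : Type u) [Field K] : Type (u + 1) :=
  RingQuot (GrothendieckRel K)

/-- The class `[X]` of a variety in the Grothendieck ring. -/
noncomputable def KVariety.grothendieckClass {K : Type u} [Field K] (X : KVariety K) :
    GrothendieckRing K :=
  RingQuot.mkRingHom (GrothendieckRel K) (FreeCommRing.of X)

/-- The Lefschetz motive `𝕃 = [𝔸¹]`. -/
noncomputable def lefschetzClass (K : Type u) [Field K] : GrothendieckRing K :=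
  (KVariety.affineSpace K (Fin 1)).grothendieckClass

/-- `𝕊 = [ℙ¹ ∖ {0, 1, ∞}]`. -/
noncomputable def threePointClass (K : Type u) [Field K] : GrothendieckRing K :=
  (KVariety.projectiveLineMinusThreePoints K).grothendieckClass

/-! ## Graphs and their hypersurfaces -/

/-- A finite graph, possibly with parallel edges and loops. Each edge carries a reference
orientation, which is only used to insert strings of bananas in a definite order. -/
structure Multigraph where
  /-- vertices -/
  V : Type
  /-- edges -/
  E : Type
  [fintypeV : Fintype V]
  [fintypeE : Fintype E]
  /-- first endpoint of an edge -/
  src : E → V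
  /-- second endpoint of an edge -/
  tgt : E → V

attribute [instance] Multigraph.fintypeV Multigraph.fintypeE

namespace Multigraph

/-- Two graphs are isomorphic if there are bijections of vertices and of edges that respect the
(unordered) endpoints of the edges. -/
def IsIsomorphic (G H : Multigraph) : Prop :=
  ∃ (φ : G.V ≃ H.V) (ψ : G.E ≃ H.E),
    ∀ e, s(φ (G.src e), φ (G.tgt e)) = s(H.src (ψ e), H.tgt (ψ e))

/-- `x` and `y` are joined by a path of edges in `T`. -/
def Joined (G : Multigraph) (T : Set G.E) : G.V → G.V → Prop :=
  Relation.EqvGen fun x y => ∃ e ∈ T, G.src e = x ∧ G.tgt e = y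

/-- `T` is (the edge set of) a spanning tree: the graph with all the vertices of `G` and the edges
in `T` is nonempty, connected and has no cycles, that is, the endpoints of an edge in `T` are not
joined by a path of other edges in `T`. -/
def IsSpanningTree (G : Multigraph) (T : Finset G.E) : Prop :=
  Nonempty G.V ∧ (∀ x y, G.Joined T x y) ∧ ∀ e ∈ T, ¬ G.Joined (T \ {e}) (G.src e) (G.tgt e)

open Classical in
/-- The Kirchhoff--Symanzik polynomial `Ψ_G = ∑_T ∏_{e ∉ T} t_e`, the sum over all the spanning
trees `T` of `G`. -/
noncomputable def kirchhoffPolynomial (K : Type u) [Field K] (G : Multigraph) :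
    MvPolynomial G.E K :=
  ∑ T : Finset G.E with G.IsSpanningTree T, ∏ e ∈ Tᶜ, MvPolynomial.X e

/-- The Grothendieck class `𝕌(G)` of the complement of the affine graph hypersurface `Ψ_G = 0`
in the affine space with one coordinate for every edge of `G`. -/
noncomputable def grothendieckClass (K : Type u) [Field K] (G : Multigraph) :
    GrothendieckRing K :=
  (KVariety.hypersurfaceComplement (G.kirchhoffPolynomial K)).grothendieckClass

/-! ## Melonic graphs -/

/-- The graph with two vertices joined by a single edge. -/
def singleEdge : Multigraph where
  V := Bool
  E := Unit
  src _ := false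
  tgt _ := true

/-- The `i`-th vertex, `0 ≤ i ≤ r`, on a string of `r ≥ 1` bananas from `x` to `y`: the vertices
with `0 < i < r` are new. -/
def stringVertex {V : Type} (x y : V) (r i : ℕ) : V ⊕ Fin (r - 1) :=
  if i = 0 then Sum.inl x else if h : i - 1 < r - 1 then Sum.inr ⟨i - 1, h⟩ else Sum.inl y

open Classical in
/-- Bananification of the edge `e` by `b = (a₁, …, a_r)`, `r ≥ 1`: the edge `e` is replaced by a
string of bananas, with `a₁, …, a_r` parallel edges respectively, from `src e` to `tgt e`. -/
noncomputable def bananify (G : Multigraph) (e : G.E) (b : List ℕ) : Multigraph where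
  V := G.V ⊕ Fin (b.length - 1)
  E := {f : G.E // f ≠ e} ⊕ (Σ j : Fin b.length, Fin (b.get j))
  src := Sum.elim (fun f => Sum.inl (G.src f.1))
    (fun f => stringVertex (G.src e) (G.tgt e) b.length f.1)
  tgt := Sum.elim (fun f => Sum.inl (G.tgt f.1))
    (fun f => stringVertex (G.src e) (G.tgt e) b.length (f.1 + 1))

end Multigraph

/-- A tuple `((a₁, …, a_r), p, k)`: replace one edge of the `k`-th banana built at stage `p` by a
string of bananas with `a₁, …, a_r` edges. -/
structure MelonicStep where
  b : List ℕ
  p : ℕ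
  k : ℕ

/-- The bananas present at stage `s` of a list of tuples: a single edge at stage `0`, and the
bananas of the `s`-th tuple at stage `s ≥ 1`. -/
def stageBananas (T : List MelonicStep) : ℕ → List ℕ
  | 0 => [1]
  | s + 1 => (T[s]?.map MelonicStep.b).getD []

/-- The list `T = (t₁, …, t_n)`, `t_s = (b_s, p_s, k_s)`, is a melonic construction. (In Lean the
tuple `t_s` is `T[s - 1]`.) -/
structure IsMelonicConstruction (T : List MelonicStep) : Prop where
  /-- the `b_s` are nonempty tuples of positive integers -/
  bananas : ∀ t ∈ T, t.b ≠ [] ∧ ∀ a ∈ t.b, 0 < a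
  /-- `0 ≤ p_s < s` -/
  stage_lt : ∀ (s : ℕ) (hs : s < T.length), T[s].p < s + 1
  /-- `1 ≤ k_s ≤ |b_{p_s}|`, with `b_0 = (1)` -/
  banana_mem : ∀ t ∈ T, 1 ≤ t.k ∧ t.k ≤ (stageBananas T t.p).length
  /-- `p_s > 0` for `s > 1` -/
  stage_pos : ∀ (s : ℕ) (hs : s < T.length), 0 < s → 0 < T[s].p
  /-- if `b_i = (a₁, …, a_r)`, at most `a_j` tuples have `p_s = i` and `k_s = j` -/
  room : ∀ (i : ℕ) (hi : i < T.length) (j : ℕ) (hj : j < T[i].b.length),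
    T.countP (fun t => t.p = i + 1 ∧ t.k = j + 1) ≤ T[i].b[j]

/-- `Builds T G ℓ`: the graph `G` is obtained from a single edge by the successive bananifications
prescribed by `T`; the label `ℓ e = (p, k)` of an edge `e` records that `e` belongs to the `k`-th
banana built at stage `p`. -/
inductive Builds : List MelonicStep → (G : Multigraph) → (G.E → ℕ × ℕ) → Prop
  | start : Builds [] Multigraph.singleEdge (fun _ => (0, 1))
  | step (T : List MelonicStep) (G : Multigraph) (ℓ : G.E → ℕ × ℕ) (hG : Builds T G ℓ)
      (t : MelonicStep) (e : G.E) (he : ℓ e = (t.p, t.k)) :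
      Builds (T ++ [t]) (G.bananify e t.b)
        (Sum.elim (fun f => ℓ f.1) (fun f => (T.length + 1, f.1 + 1)))

/-- A melonic graph is a graph determined, up to isomorphism, by a melonic construction. -/
def Multigraph.IsMelonic (G : Multigraph) : Prop :=
  ∃ T : List MelonicStep, IsMelonicConstruction T ∧
    ∃ (H : Multigraph) (ℓ : H.E → ℕ × ℕ), Builds T H ℓ ∧ H.IsIsomorphic G

/-! Think of a piece of the graph attached at two terminals as an electrical network. It has a pair
of polynomials: `A`, the sum over its spanning trees, and `B`, the sum over its spanning forests
with two components that separate the terminals. A single edge has the pair `(1, t)`, and `B / A` is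
the effective resistance. In series the pairs compose to `(A₁A₂, A₁B₂ + B₁A₂)`, so resistances add;
in parallel the same rule holds with `A` and `B` exchanged.

The homogeneous tree sum `∑_T ∏_{e ∈ T} A_e ∏_{e ∉ T} B_e` allows an edge of a graph to be replaced
by a network. By `isTree_bananify_iff` and `treeSum_bananify`, the tree sum of a bananification of
`G` is a tree sum of `G` itself, in which the edge `e` carries the pair of the string of bananas.
Unwinding the construction from its last stage ends at a single edge that carries the pair `(A, B)`
of a series-parallel network, whose tree sum is `A`.

The statement to propagate concerns three loci: resistance zero (`B = 0`, `A` invertible),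
resistance infinity (`A = 0`, `B` invertible) and resistance one (`A = B` invertible). Rescaling all
variables rescales `B / A`, so the locus where `A` and `B` are both invertible is the product of
`𝔾ₘ` and the resistance-one locus. The class of `𝔾ₘ` is `𝕊 + 1`, so the three classes determine the
class of `A ≠ 0`, without subtraction.

The three classes stay polynomials in `𝕊` with nonnegative coefficients under exchange of `A` and
`B`, and under series composition (`IsPositivePair.series`). For instance, `r₁ + r₂ = 1` splits into
`(0, 1)`, `(1, 0)` and the case of two invertible summands; the last one is a product of both
resistance-one loci with a line minus two points, which is `ℙ¹ ∖ {0, 1, ∞}`. Only sums and products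
of nonnegative classes ever occur.

Equalities of classes are proved on points with values in arbitrary `K`-algebras: a natural
bijection of points is an isomorphism of coordinate rings (`IsCoordinateRing.specClass_eq`), and
scissor relations supply the distinction between `f = 0` and `f` invertible. -/

namespace Multigraph

/-! ### Connectedness and spanning trees -/

/-- The edges in `T` connect all the vertices of `G`, which has at least one vertex. -/
def IsConn (G : Multigraph) (T : Set G.E) : Prop :=
  Nonempty G.V ∧ ∀ f : G.V → Prop, (∀ e ∈ T, f (G.src e) ↔ f (G.tgt e)) → ∀ x y, f x ↔ f y

/-- Paths are traded for two-colourings of the vertices that are constant along `T`. For the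
converse, the colouring to test is "joined to `x`". Connectedness of a modified graph then reduces
to extending and restricting colourings. -/
theorem joined_iff (G : Multigraph) (T : Set G.E) (x y : G.V) :
    G.Joined T x y ↔
      ∀ f : G.V → Prop, (∀ e ∈ T, f (G.src e) ↔ f (G.tgt e)) → (f x ↔ f y) := by
  constructor
  · intro h f hf
    induction h with
    | rel x y h =>
      obtain ⟨e, he, rfl, rfl⟩ := h
      exact hf e he
    | refl x => exact Iff.rfl
    | symm x y _ ih => exact ih.symm
    | trans x y z _ _ ih₁ ih₂ => exact ih₁.trans ih₂
  · intro h
    refine (h (fun z => G.Joined T x z) fun e he => ?_).1 (Relation.EqvGen.refl x)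
    have : G.Joined T (G.src e) (G.tgt e) := Relation.EqvGen.rel _ _ ⟨e, he, rfl, rfl⟩
    exact ⟨fun h => h.trans _ _ _ this, fun h => h.trans _ _ _ (this.symm _ _)⟩

theorem IsConn.mono {G : Multigraph} {S T : Set G.E} (h : G.IsConn S) (hST : S ⊆ T) :
    G.IsConn T :=
  ⟨h.1, fun f hf => h.2 f fun e he => hf e (hST he)⟩

/-- A spanning tree is a minimal connected set of edges. -/
def IsTree (G : Multigraph) (T : Set G.E) : Prop :=
  G.IsConn T ∧ ∀ e ∈ T, ¬ G.IsConn (T \ {e})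

/-- Once `T` connects everything, the endpoints of `e` are joined by `T \ {e}` exactly when `T \
{e}` still connects everything: a colouring constant along `T \ {e}` is then also constant along
`e`. -/
theorem isSpanningTree_iff (G : Multigraph) (T : Finset G.E) :
    G.IsSpanningTree T ↔ G.IsTree (T : Set G.E) := by
  have hconn : (Nonempty G.V ∧ ∀ x y, G.Joined T x y) ↔ G.IsConn (T : Set G.E) := by
    simp only [joined_iff, IsConn]
    exact and_congr_right fun _ => ⟨fun h f hf x y => h x y f hf, fun h x y f hf => h f hf x y⟩
  rw [IsSpanningTree, ← and_assoc, hconn, IsTree]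
  refine and_congr_right fun hT => forall₂_congr fun e he => not_congr ?_
  rw [joined_iff]
  refine ⟨fun h => ⟨hT.1, fun f hf => hT.2 f fun e' he' => ?_⟩, fun h f hf => h.2 f hf _ _⟩
  by_cases hee : e' = e
  · subst hee
    exact h f hf
  · exact hf e' ⟨he', hee⟩

/-! ### The homogeneous tree sum -/

section treeSum

variable {R : Type*} [CommSemiring R]

open Classical in
/-- The homogeneous form `∑_T ∏_{e ∈ T} A_e ∏_{e ∉ T} B_e` of the Kirchhoff--Symanzik polynomial,
the sum over all the spanning trees of `G`. -/
noncomputable def treeSum (G : Multigraph) (A B : G.E → R) : R :=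
  ∑ T : Finset G.E, if G.IsTree (T : Set G.E) then (∏ e ∈ T, A e) * ∏ e ∈ Tᶜ, B e else 0

theorem kirchhoffPolynomial_eq_treeSum (K : Type u) [Field K] (G : Multigraph) :
    G.kirchhoffPolynomial K = G.treeSum (fun _ => 1) MvPolynomial.X := by
  classical
  simp only [kirchhoffPolynomial, treeSum, Finset.sum_filter, isSpanningTree_iff,
    Finset.prod_const_one, one_mul]

theorem IsConn.of_iso {G H : Multigraph} (φ : G.V ≃ H.V) (ψ : G.E ≃ H.E)
    (h : ∀ e, s(φ (G.src e), φ (G.tgt e)) = s(H.src (ψ e), H.tgt (ψ e))) (T : Set G.E)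
    (hT : G.IsConn T) : H.IsConn (ψ '' T) := by
  obtain ⟨⟨v⟩, hT⟩ := hT
  refine ⟨⟨φ v⟩, fun f hf x y => ?_⟩
  have := hT (f ∘ φ) (fun e he => ?_) (φ.symm x) (φ.symm y)
  · simpa using this
  · have h1 := hf (ψ e) ⟨e, he, rfl⟩
    rcases Sym2.eq_iff.1 (h e) with ⟨h2, h3⟩ | ⟨h2, h3⟩
    · simpa [h2, h3] using h1
    · simpa [h2, h3] using h1.symm

theorem isTree_image_iff {G H : Multigraph} (φ : G.V ≃ H.V) (ψ : G.E ≃ H.E)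
    (h : ∀ e, s(φ (G.src e), φ (G.tgt e)) = s(H.src (ψ e), H.tgt (ψ e))) (T : Set G.E) :
    H.IsTree (ψ '' T) ↔ G.IsTree T := by
  have key : ∀ S : Set G.E, H.IsConn (ψ '' S) ↔ G.IsConn S := by
    refine fun S => ⟨fun hS => ?_, IsConn.of_iso φ ψ h S⟩
    have h' : ∀ e, s(φ.symm (H.src e), φ.symm (H.tgt e)) =
        s(G.src (ψ.symm e), G.tgt (ψ.symm e)) := fun e => by
      have := congrArg (Sym2.map φ.symm) (h (ψ.symm e))
      simpa using this.symm
    simpa [Set.image_image] using IsConn.of_iso φ.symm ψ.symm h' _ hS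
  simp only [IsTree, key, Set.forall_mem_image]
  refine and_congr_right fun _ => forall₂_congr fun e _ => not_congr ?_
  rw [← key, Set.image_sdiff ψ.injective, Set.image_singleton]

theorem treeSum_of_iso {G H : Multigraph} (φ : G.V ≃ H.V) (ψ : G.E ≃ H.E)
    (h : ∀ e, s(φ (G.src e), φ (G.tgt e)) = s(H.src (ψ e), H.tgt (ψ e))) (A B : H.E → R) :
    H.treeSum A B = G.treeSum (A ∘ ψ) (B ∘ ψ) := by
  classical
  unfold treeSum
  refine (Fintype.sum_equiv ψ.finsetCongr _ _ fun T => ?_).symm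
  have : ((ψ.finsetCongr T : Finset H.E) : Set H.E) = ψ '' T := by simp
  rw [this, isTree_image_iff φ ψ h]
  have hc : (ψ.finsetCongr T)ᶜ = ψ.finsetCongr Tᶜ := by
    ext x; simp [Equiv.finsetCongr_apply, Finset.mem_map_equiv]
  rw [hc]
  simp [Equiv.finsetCongr_apply, Finset.prod_map]

theorem treeSum_singleEdge (A B : singleEdge.E → R) : singleEdge.treeSum A B = A () := by
  classical
  have huniq : ∀ x : singleEdge.E, x = () := fun _ => rfl
  have h0 : ¬ singleEdge.IsConn ∅ := fun h => by
    have := h.2 (fun b : Bool => b = true) (fun e he => he.elim) true false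
    exact Bool.false_ne_true (this.1 rfl)
  have h1 : singleEdge.IsTree Set.univ := by
    refine ⟨⟨⟨true⟩, fun f hf => ?_⟩, fun e _ h => h0 (h.mono fun x hx => hx.2 rfl)⟩
    have := hf () trivial
    change f false ↔ f true at this
    change ∀ x y : Bool, f x ↔ f y
    simp [this]
  rw [treeSum, Fintype.sum_eq_single Finset.univ]
  · rw [Finset.coe_univ, if_pos h1, Finset.compl_univ, Finset.prod_empty, mul_one]
    exact Fintype.prod_unique (ι := Unit) A
  · refine fun T hT => if_neg fun h => h0 (h.1.mono fun x hx => hT ?_)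
    ext y
    exact ⟨fun _ => Finset.mem_univ _, fun _ => hx⟩

end treeSum
end Multigraph

/-! ### Spanning trees of a bananification -/

namespace Multigraph

section stringVertex

variable {V : Type} (x y : V) {r : ℕ}

theorem stringVertex_self (hr : r ≠ 0) : stringVertex x y r r = Sum.inl y := by
  simp [stringVertex, hr]

theorem stringVertex_succ (k : Fin (r - 1)) : stringVertex x y r (k + 1) = Sum.inr k := by
  simp [stringVertex]

/-- A predicate on the vertices of a string of bananas is given by its values along the string. -/
theorem elim_stringVertex_iff (hr : r ≠ 0) (f : V → Prop) (g : ℕ → Prop) (h0 : f x ↔ g 0)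
    (h1 : f y ↔ g r) {i : ℕ} (hi : i ≤ r) :
    Sum.elim f (fun k : Fin (r - 1) => g (k + 1)) (stringVertex x y r i) ↔ g i := by
  obtain _ | i := i
  · exact h0
  · rcases hi.lt_or_eq with hi | rfl
    · rw [stringVertex_succ x y ⟨i, by omega⟩]
      rfl
    · rw [stringVertex_self x y hr]
      exact h1

end stringVertex

section bananify

variable {G : Multigraph} {e : G.E} {b : List ℕ}

/-- The edge of a bananification of `G` given by an edge of `G`. -/
def oldEdge (f : {f : G.E // f ≠ e}) : (G.bananify e b).E := Sum.inl f

/-- The `i`-th edge of the `j`-th banana of a bananification of `G`. -/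
def newEdge (j : Fin b.length) (i : Fin (b.get j)) : (G.bananify e b).E := Sum.inr ⟨j, i⟩

@[elab_as_elim]
theorem edge_cases {motive : (G.bananify e b).E → Prop} (a : (G.bananify e b).E)
    (old : ∀ f, motive (oldEdge f)) (new : ∀ j i, motive (newEdge j i)) : motive a := by
  rcases a with f | ⟨j, i⟩
  · exact old f
  · exact new j i

theorem newEdge_injective (j : Fin b.length) :
    Function.Injective (newEdge (G := G) (e := e) (b := b) j) := fun i i' h => by
  have := Sum.inr_injective h
  simpa using this

/-- The edges of `G` in a set of edges of a bananification of `G`. -/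
def baseEdges (T : Set (G.bananify e b).E) : Set G.E :=
  {f | ∃ h : f ≠ e, oldEdge ⟨f, h⟩ ∈ T}

/-- `T` has an edge in the `j`-th of the new bananas. -/
def Meets (T : Set (G.bananify e b).E) (j : Fin b.length) : Prop :=
  ∃ i, newEdge j i ∈ T

/-- The vertices of the new string of bananas. -/
noncomputable def bananaVertex (G : Multigraph) (e : G.E) (b : List ℕ) (i : ℕ) :
    (G.bananify e b).V :=
  stringVertex (G.src e) (G.tgt e) b.length i

/-- Parallel edges impose the same condition on a colouring, so for connectedness only the set of
bananas met by `T` matters. -/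
theorem forall_edge_iff (T : Set (G.bananify e b).E) (f : (G.bananify e b).V → Prop) :
    (∀ a ∈ T, f ((G.bananify e b).src a) ↔ f ((G.bananify e b).tgt a)) ↔
      (∀ a ∈ baseEdges T, f (Sum.inl (G.src a)) ↔ f (Sum.inl (G.tgt a))) ∧
      ∀ j, Meets T j → (f (bananaVertex G e b j) ↔ f (bananaVertex G e b (j + 1))) := by
  constructor
  · exact fun h => ⟨fun a ⟨_, ha⟩ => h _ ha, fun j ⟨i, hi⟩ => h _ hi⟩
  · rintro ⟨h1, h2⟩ (⟨a, ha⟩ | ⟨j, i⟩) h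
    · exact h1 a ⟨ha, h⟩
    · exact h2 j ⟨i, h⟩

theorem bananaVertex_iff {T : Set (G.bananify e b).E} {f : (G.bananify e b).V → Prop}
    (hf : ∀ j, Meets T j → (f (bananaVertex G e b j) ↔ f (bananaVertex G e b (j + 1))))
    (i k : ℕ) (hk : i + k ≤ b.length)
    (h : ∀ j : Fin b.length, i ≤ j → j < i + k → Meets T j) :
    f (bananaVertex G e b i) ↔ f (bananaVertex G e b (i + k)) := by
  induction k with
  | zero => rfl
  | succ k ih =>
    rw [ih (by omega) fun j h1 h2 => h j h1 (by omega)]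
    exact hf ⟨i + k, by omega⟩ (h _ (by simp) (by simp))

/-- A string of bananas that is met everywhere conducts from one end to the other, like the edge
`e`. -/
theorem isConn_bananify_of_meets (hb : b ≠ []) {T : Set (G.bananify e b).E} (hT : ∀ j, Meets T j) :
    (G.bananify e b).IsConn T ↔ G.IsConn (insert e (baseEdges T)) := by
  have hr : b.length ≠ 0 := by simpa using hb
  refine ⟨fun h => ⟨⟨G.src e⟩, fun f hf x y => ?_⟩, fun h => ⟨⟨Sum.inl (G.src e)⟩, fun f hf => ?_⟩⟩
  -- A colouring constant along `e` has the same value at both ends of the string, and this value is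
  -- given to all interior vertices.
  · refine h.2 (Sum.elim f fun _ => f (G.src e)) ((forall_edge_iff _ _).2
      ⟨fun a ha => hf a (Set.mem_insert_of_mem _ ha), fun j _ => ?_⟩) (Sum.inl x) (Sum.inl y)
    have := @elim_stringVertex_iff _ (G.src e) (G.tgt e) _ hr f (fun _ => f (G.src e)) Iff.rfl
      (hf e (Set.mem_insert _ _)).symm
    exact (this j.2.le).trans (this j.2).symm
  · obtain ⟨h1, h2⟩ := (forall_edge_iff _ _).1 hf
    have hs : ∀ i ≤ b.length, f (bananaVertex G e b i) ↔ f (Sum.inl (G.src e)) := fun i hi => by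
      have := bananaVertex_iff h2 0 i (by omega) fun j _ _ => hT j
      rw [zero_add] at this
      exact this.symm
    have hc := h.2 (fun v => f (Sum.inl v)) (by
      rintro a (rfl | ha)
      · have := hs _ le_rfl
        rw [bananaVertex, stringVertex_self _ _ hr] at this
        exact this.symm
      · exact h1 a ha)
    have : ∀ x, f x ↔ f (Sum.inl (G.src e)) := by
      rintro (x | k)
      · exact hc _ _
      · have := hs (k + 1) (by have := k.2; omega)
        rwa [bananaVertex, stringVertex_succ] at this
    exact fun x y => (this x).trans (this y).symm

/-- A string interrupted at one banana hangs its interior vertices on the two ends without joining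
them, like a deleted edge. -/
theorem isConn_bananify_of_meets_of_ne (hb : b ≠ []) {T : Set (G.bananify e b).E} (j : Fin b.length)
    (hj : ¬ Meets T j) (hT : ∀ k, k ≠ j → Meets T k) :
    (G.bananify e b).IsConn T ↔ G.IsConn (baseEdges T) := by
  have hr : b.length ≠ 0 := by simpa using hb
  refine ⟨fun h => ⟨⟨G.src e⟩, fun f hf x y => ?_⟩, fun h => ⟨⟨Sum.inl (G.src e)⟩, fun f hf => ?_⟩⟩
  -- The `j`-th banana, counted from `0`, joins the string vertices `j` and `j + 1`. Vertices up to
  -- `j` take the colour of the source, later ones that of the target.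
  · set g : ℕ → Prop := fun i => (i ≤ j ∧ f (G.src e)) ∨ (¬ i ≤ j ∧ f (G.tgt e))
    refine h.2 (Sum.elim f fun k => g (k + 1)) ((forall_edge_iff _ _).2
      ⟨hf, fun k hk => ?_⟩) (Sum.inl x) (Sum.inl y)
    have := @elim_stringVertex_iff _ (G.src e) (G.tgt e) _ hr f g (by simp [g])
      (by have := j.2; simp [g])
    refine (this k.2.le).trans (Iff.trans ?_ (this k.2).symm)
    have hkj : (k : ℕ) ≠ j := fun h => hj (Fin.ext h ▸ hk)
    have : (k : ℕ) ≤ j ↔ (k : ℕ) + 1 ≤ j := by omega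
    simp only [g, this]
  · obtain ⟨h1, h2⟩ := (forall_edge_iff _ _).1 hf
    have hc := h.2 (fun v => f (Sum.inl v)) h1
    have : ∀ x, f x ↔ f (Sum.inl (G.src e)) := by
      rintro (x | k)
      · exact hc _ _
      · have hk := k.2
        have hv : bananaVertex G e b (k + 1) = Sum.inr k := stringVertex_succ _ _ _
        by_cases hkj : (k : ℕ) + 1 ≤ j
        · have := bananaVertex_iff h2 0 (k + 1) (by omega)
            fun l _ hl => hT l fun h => by subst h; omega
          rw [zero_add, hv] at this
          exact this.symm
        · have := bananaVertex_iff h2 (k + 1) (b.length - (k + 1)) (by omega)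
            fun l hl _ => hT l fun h => by subst h; omega
          rw [hv, show (k : ℕ) + 1 + (b.length - (k + 1)) = b.length by omega,
            bananaVertex, stringVertex_self _ _ hr] at this
          exact this.trans (hc _ _)
    exact fun x y => (this x).trans (this y).symm

/-- With bananas `i < j` both interrupted, the string vertices `i + 1, …, j` are cut off from the
rest; `g` is the indicator of this stretch. -/
theorem not_isConn_bananify (hb : b ≠ []) {T : Set (G.bananify e b).E} (i j : Fin b.length)
    (hij : i < j) (hi : ¬ Meets T i) (hj : ¬ Meets T j) : ¬ (G.bananify e b).IsConn T := by
  intro h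
  have hr : b.length ≠ 0 := by simpa using hb
  set g : ℕ → Prop := fun k => i < k ∧ k ≤ j
  have hj2 := j.2
  have hlt : (i : ℕ) < j := hij
  have hg := @elim_stringVertex_iff _ (G.src e) (G.tgt e) _ hr (fun _ => False) g (by simp [g])
      (by simp [g])
  have := h.2 (Sum.elim (fun _ => False) fun k => g (k + 1)) ((forall_edge_iff _ _).2
      ⟨fun _ _ => Iff.rfl, fun k hk => ?_⟩) (Sum.inl (G.src e)) (bananaVertex G e b j)
  · exact this.2 ((hg j.2.le).2 ⟨hlt, le_rfl⟩)
  · refine (hg k.2.le).trans (Iff.trans ?_ (hg k.2).symm)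
    have h1 : (k : ℕ) ≠ i := fun h => hi (Fin.ext h ▸ hk)
    have h2 : (k : ℕ) ≠ j := fun h => hj (Fin.ext h ▸ hk)
    simp only [g]
    omega

theorem baseEdges_diff_inl (T : Set (G.bananify e b).E) (f : {f : G.E // f ≠ e}) :
    baseEdges (T \ {oldEdge f}) = baseEdges T \ {f.1} := by
  ext a
  constructor
  · rintro ⟨h, h1, h2⟩
    exact ⟨⟨h, h1⟩, fun h3 => h2 (congrArg Sum.inl (Subtype.ext h3))⟩
  · rintro ⟨⟨h, h1⟩, h2⟩
    exact ⟨h, h1, fun h3 => h2 (congrArg Subtype.val (Sum.inl_injective h3))⟩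

theorem baseEdges_diff_inr (T : Set (G.bananify e b).E) (j : Fin b.length)
    (i : Fin (b.get j)) :
    baseEdges (T \ {newEdge j i}) = baseEdges T := by
  ext a
  exact ⟨fun ⟨h, h1, _⟩ => ⟨h, h1⟩, fun ⟨h, h1⟩ => ⟨h, h1, fun h2 => Sum.inl_ne_inr h2⟩⟩

theorem meets_diff_inl (T : Set (G.bananify e b).E) (f : {f : G.E // f ≠ e}) (j : Fin b.length) :
    Meets (T \ {oldEdge f}) j ↔ Meets T j :=
  ⟨fun ⟨i, h1, _⟩ => ⟨i, h1⟩, fun ⟨i, h1⟩ => ⟨i, h1, fun h2 => Sum.inr_ne_inl h2⟩⟩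

theorem meets_diff_inr_of_ne (T : Set (G.bananify e b).E) {j k : Fin b.length} (h : k ≠ j)
    (i : Fin (b.get j)) : Meets (T \ {newEdge j i}) k ↔ Meets T k :=
  ⟨fun ⟨i, h1, _⟩ => ⟨i, h1⟩,
    fun ⟨i, h1⟩ => ⟨i, h1, fun h2 => h (congrArg Sigma.fst (Sum.inr_injective h2))⟩⟩

theorem notMem_baseEdges (T : Set (G.bananify e b).E) : e ∉ baseEdges T := fun h => h.1 rfl

/-- Minimality allows at most one edge per banana, and connectedness allows at most one missed
banana. If none is missed, the string plays the role of `e` as a tree edge; if one is missed, it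
plays the role of `e` outside the tree. -/
theorem isTree_bananify_iff (hb : b ≠ []) (T : Set (G.bananify e b).E) :
    (G.bananify e b).IsTree T ↔
      ((∀ j, ∃! i, newEdge j i ∈ T) ∧ G.IsTree (insert e (baseEdges T))) ∨
      ∃ j, (¬ Meets T j ∧ ∀ k, k ≠ j → ∃! i, newEdge k i ∈ T) ∧ G.IsTree (baseEdges T) := by
  have hins : ∀ a, a ≠ e → insert e (baseEdges T \ {a}) = insert e (baseEdges T) \ {a} :=
    fun a ha => Set.insert_sdiff_singleton_comm ha.symm _
  have huniq : ∀ j i, newEdge j i ∈ T → (∃! i, newEdge j i ∈ T) →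
      ¬ Meets (T \ {newEdge j i}) j := by
    rintro j i hi ⟨i', _, h⟩ ⟨k, hk, hk'⟩
    rw [h i hi] at hk'
    rw [h k hk] at hk'
    exact hk' rfl
  constructor
  · rintro ⟨hc, hmin⟩
    by_cases hall : ∀ j, Meets T j
    · left
      have hbase := (isConn_bananify_of_meets hb hall).1 hc
      have hu : ∀ j, ∃! i, newEdge j i ∈ T := by
        intro j
        obtain ⟨i, hi⟩ := hall j
        refine ⟨i, hi, fun i' hi' => by_contra fun hne => hmin _ hi' ?_⟩
        rw [isConn_bananify_of_meets hb, baseEdges_diff_inr]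
        · exact hbase
        · intro k
          by_cases hk : k = j
          · subst hk
            exact ⟨i, hi, fun h => hne (newEdge_injective _ h).symm⟩
          · exact (meets_diff_inr_of_ne T hk i').2 (hall k)
      refine ⟨hu, hbase, ?_⟩
      rintro a ha hconn
      by_cases hae : a = e
      -- If the tree of `G` could do without `e`, then `T` could do without its only edge in an
      -- arbitrary banana.
      · subst hae
        have j : Fin b.length := ⟨0, List.length_pos_of_ne_nil hb⟩
        obtain ⟨i, hi⟩ := hall j
        refine hmin _ hi ?_
        rw [isConn_bananify_of_meets_of_ne hb j (huniq j i hi (hu j))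
          (fun k hk => (meets_diff_inr_of_ne T hk i).2 (hall k)), baseEdges_diff_inr]
        exact hconn.mono fun x hx => hx.1.resolve_left hx.2
      · obtain ⟨h1, h2⟩ := ha.resolve_left hae
        refine hmin _ h2 ?_
        rw [isConn_bananify_of_meets hb (fun j => (meets_diff_inl _ _ _).2 (hall j)),
          baseEdges_diff_inl, hins _ h1]
        exact hconn
    · right
      push Not at hall
      obtain ⟨j, hj⟩ := hall
      have hk : ∀ k, k ≠ j → Meets T k := by
        intro k hk
        by_contra hk'
        rcases lt_or_gt_of_ne hk with h | h
        · exact not_isConn_bananify hb _ _ h hk' hj hc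
        · exact not_isConn_bananify hb _ _ h hj hk' hc
      have hbase := (isConn_bananify_of_meets_of_ne hb j hj hk).1 hc
      refine ⟨j, ⟨hj, fun k hkj => ?_⟩, hbase, ?_⟩
      · obtain ⟨i, hi⟩ := hk k hkj
        refine ⟨i, hi, fun i' hi' => by_contra fun hne => hmin _ hi' ?_⟩
        rw [isConn_bananify_of_meets_of_ne hb j, baseEdges_diff_inr]
        · exact hbase
        · rwa [meets_diff_inr_of_ne T hkj.symm]
        · intro l hl
          by_cases hlk : l = k
          · subst hlk
            exact ⟨i, hi, fun h => hne (newEdge_injective _ h).symm⟩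
          · exact (meets_diff_inr_of_ne T hlk i').2 (hk l hl)
      · rintro a ⟨h1, h2⟩ hconn
        refine hmin _ h2 ?_
        rwa [isConn_bananify_of_meets_of_ne hb j ((meets_diff_inl _ _ _).not.2 hj)
          (fun k hkj => (meets_diff_inl _ _ _).2 (hk k hkj)), baseEdges_diff_inl]
  · rintro (⟨hu, hc, hmin⟩ | ⟨j, ⟨hj, hu⟩, hc, hmin⟩)
    · have hall : ∀ j, Meets T j := fun j => (hu j).exists
      refine ⟨(isConn_bananify_of_meets hb hall).2 hc, ?_⟩
      intro t ht
      induction t using edge_cases with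
      | old f =>
        rw [isConn_bananify_of_meets hb (fun j => (meets_diff_inl _ _ _).2 (hall j)),
          baseEdges_diff_inl, hins _ f.2]
        exact hmin _ (Set.mem_insert_of_mem _ ⟨f.2, ht⟩)
      | new j i =>
        rw [isConn_bananify_of_meets_of_ne hb j (huniq j i ht (hu j))
          (fun k hk => (meets_diff_inr_of_ne T hk i).2 (hall k)), baseEdges_diff_inr]
        refine fun h => hmin e (Set.mem_insert _ _) (h.mono fun x hx => ⟨Or.inr hx, ?_⟩)
        rintro rfl
        exact notMem_baseEdges T hx
    · have hk : ∀ k, k ≠ j → Meets T k := fun k hk => (hu k hk).exists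
      refine ⟨(isConn_bananify_of_meets_of_ne hb j hj hk).2 hc, ?_⟩
      intro t ht
      induction t using edge_cases with
      | old f =>
        rw [isConn_bananify_of_meets_of_ne hb j ((meets_diff_inl _ _ _).not.2 hj)
          (fun k hkj => (meets_diff_inl _ _ _).2 (hk k hkj)), baseEdges_diff_inl]
        exact hmin _ ⟨f.2, ht⟩
      | new k i =>
        have hkj : k ≠ j := by
          rintro rfl
          exact hj ⟨i, ht⟩
        have h1 := huniq k i ht (hu k hkj)
        have h2 := (meets_diff_inr_of_ne T hkj.symm i).not.2 hj
        rcases lt_or_gt_of_ne hkj with h | h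
        · exact not_isConn_bananify hb _ _ h h1 h2
        · exact not_isConn_bananify hb _ _ h h2 h1

end bananify
end Multigraph

/-! ### Identities for sums over sets of edges -/

section sums

variable {R : Type*} [CommSemiring R]

/-- `∑_{j ∈ J} y_j ∏_{k ∈ J, k ≠ j} x_k`. -/
def seriesSum {ι : Type*} [DecidableEq ι] (x y : ι → R) (J : Finset ι) : R :=
  ∑ j ∈ J, y j * ∏ k ∈ J.erase j, x k

open Classical in
theorem sum_finset_subtype_ne {E : Type*} [Fintype E] (e : E) (F : Finset E → R) :
    ∑ T, F T = ∑ T : Finset {f // f ≠ e}, F (T.map (Function.Embedding.subtype _)) +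
      ∑ T : Finset {f // f ≠ e}, F (insert e (T.map (Function.Embedding.subtype _))) := by
  have key : ∀ g : Finset E → R, ∑ T ∈ (Finset.univ.erase e).powerset, g T =
      ∑ T : Finset {f // f ≠ e}, g (T.map (Function.Embedding.subtype _)) := by
    intro g
    refine Finset.sum_nbij' (fun T => T.subtype (· ≠ e))
      (fun T => T.map (Function.Embedding.subtype _)) (by simp) ?_ ?_ ?_ ?_
    · intro T _
      simp only [Finset.mem_powerset]
      intro x hx
      simp only [Finset.mem_map, Function.Embedding.subtype_apply] at hx
      obtain ⟨y, _, rfl⟩ := hx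
      simpa using y.2
    · intro T hT
      rw [Finset.subtype_map_of_mem]
      intro x hx
      exact Finset.ne_of_mem_erase (Finset.mem_powerset.1 hT hx)
    · intro T _
      ext x
      simpa using fun _ => x.2
    · intro T hT
      rw [Finset.subtype_map_of_mem]
      intro x hx
      exact Finset.ne_of_mem_erase (Finset.mem_powerset.1 hT hx)
  rw [← key, ← key fun T => F (insert e T),
    ← Finset.sum_powerset_insert (Finset.notMem_erase e _), Finset.insert_erase (Finset.mem_univ _),
    Finset.powerset_univ]

theorem sum_existsUnique_mem {α : Type*} [Fintype α] [DecidableEq α]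
    [DecidablePred fun S : Finset α => ∃! i, i ∈ S] (x y : α → R) :
    ∑ S : Finset α, (if ∃! i, i ∈ S then ∏ a, if a ∈ S then x a else y a else 0) =
      seriesSum y x Finset.univ := by
  have : (Finset.univ.filter fun S : Finset α => ∃! i, i ∈ S) =
      Finset.univ.map ⟨fun i => {i}, Finset.singleton_injective⟩ := by
    ext S
    simp only [Finset.mem_filter, Finset.mem_univ, true_and, Finset.mem_map,
      Function.Embedding.coeFn_mk]
    constructor
    · rintro ⟨i, hi, h⟩
      refine ⟨i, ?_⟩
      ext k
      rw [Finset.mem_singleton]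
      exact ⟨fun h => h ▸ hi, fun hk => h k hk⟩
    · rintro ⟨i, rfl⟩
      exact ⟨i, by simp, fun k hk => by simpa using hk⟩
  rw [← Finset.sum_filter, this, Finset.sum_map, seriesSum]
  refine Finset.sum_congr rfl fun i _ => ?_
  rw [← Finset.mul_prod_erase _ _ (Finset.mem_univ i)]
  congr 1
  · simp
  · refine Finset.prod_congr rfl fun k hk => ?_
    simp [Finset.ne_of_mem_erase hk]

/-- The alternatives exclude each other, so the indicator of their disjunction is the sum of their
indicators. -/
theorem ite_or_exists {ι : Type*} [Fintype ι] {C P X Y : Prop} {Q : ι → Prop} [Decidable C]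
    [Decidable P] [Decidable X] [Decidable Y] [DecidablePred Q]
    (hC : C ↔ (P ∧ X) ∨ ∃ j, Q j ∧ Y)
    (hPQ : ∀ j, P → ¬ Q j) (hQ : ∀ j k, Q j → Q k → j = k) (w : R) :
    (if C then w else 0) =
      (if P then if X then w else 0 else 0) + ∑ j, if Q j then if Y then w else 0 else 0 := by
  classical
  rw [if_congr hC rfl rfl]
  by_cases hP : P
  · have : ∀ j, ¬ Q j := fun j => hPQ j hP
    simp [hP, this]
  · by_cases h : ∃ j, Q j
    · obtain ⟨j, hj⟩ := h
      have hjk : ∀ k, Q k ↔ k = j := fun k => ⟨fun hk => hQ _ _ hk hj, fun h => h ▸ hj⟩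
      simp [hP, hjk]
    · push Not at h
      simp [hP, h]

theorem sum_ite_forall_prod {ι : Type*} [Fintype ι] [DecidableEq ι] {α : ι → Type*}
    [∀ j, Fintype (α j)] [∀ j, DecidableEq (α j)]
    (p : ∀ j, α j → Prop) [∀ j, DecidablePred (p j)]
    [DecidablePred fun S : ∀ j, α j => ∀ j, p j (S j)] (v : ∀ j, α j → R) :
    (∑ S : ∀ j, α j, if ∀ j, p j (S j) then ∏ j, v j (S j) else 0) =
      ∏ j, ∑ S, if p j S then v j S else 0 := by
  rw [Finset.prod_univ_sum, Fintype.piFinset_univ]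
  refine Finset.sum_congr rfl fun S _ => ?_
  rw [Finset.prod_ite_zero]
  simp

end sums

/-! ### The tree sum of a bananification -/

namespace Multigraph

variable {R : Type*} [CommSemiring R] {G : Multigraph} {e : G.E} {b : List ℕ}

open Classical in
theorem treeSum_eq (G : Multigraph) (A B : G.E → R) : G.treeSum A B =
    ∑ T : Finset G.E, if G.IsTree (T : Set G.E) then ∏ a, if a ∈ T then A a else B a else 0 := by
  refine Finset.sum_congr rfl fun T _ => ?_
  rw [Finset.prod_ite]
  congr! 3
  · ext; simp
  · ext; simp

-- The tree sum is a linear form in the pair `(A e, B e)`, with coefficients that involve only the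
-- other edges. This is what makes the pair of `e` replaceable by that of a network.
open Classical in
theorem treeSum_split (G : Multigraph) (e : G.E) (A B : G.E → R) : G.treeSum A B =
    (∑ T : Finset {f // f ≠ e}, if G.IsTree (Subtype.val '' (T : Set {f // f ≠ e})) then
      ∏ a : {f // f ≠ e}, if a ∈ T then A a else B a else 0) * B e +
    (∑ T : Finset {f // f ≠ e}, if G.IsTree (insert e (Subtype.val '' (T : Set {f // f ≠ e}))) then
      ∏ a : {f // f ≠ e}, if a ∈ T then A a else B a else 0) * A e := by
  have hp : ∀ g : G.E → R, ∏ a, g a = (∏ a : {f // f ≠ e}, g a) * g e := fun g => by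
    rw [← Finset.mul_prod_erase _ _ (Finset.mem_univ e), mul_comm]
    congr 1
    exact Finset.prod_subtype _ (by simp) _
  rw [treeSum_eq, sum_finset_subtype_ne e, Finset.sum_mul, Finset.sum_mul]
  congr 1
  · refine Finset.sum_congr rfl fun T _ => ?_
    rw [Finset.coe_map, ite_mul, zero_mul, hp]
    congr 2
    · refine Finset.prod_congr rfl fun a _ => ?_
      simp [a.2]
    · simp
  · refine Finset.sum_congr rfl fun T _ => ?_
    rw [Finset.coe_insert, Finset.coe_map, ite_mul, zero_mul, hp]
    congr 2
    · refine Finset.prod_congr rfl fun a _ => ?_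
      simp [a.2]
    · simp

/-- The set of edges of a bananification of `G` with given edges of `G` and of the bananas. -/
def joinEdges (T : Finset {f : G.E // f ≠ e}) (S : ∀ j : Fin b.length, Finset (Fin (b.get j))) :
    Finset (G.bananify e b).E :=
  T.disjSum (Finset.univ.sigma S)

variable (T : Finset {f : G.E // f ≠ e}) (S : ∀ j : Fin b.length, Finset (Fin (b.get j)))

theorem oldEdge_mem_joinEdges (f : {f : G.E // f ≠ e}) :
    oldEdge f ∈ joinEdges T S ↔ f ∈ T :=
  Finset.inl_mem_disjSum

theorem newEdge_mem_joinEdges (j : Fin b.length) (i : Fin (b.get j)) :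
    newEdge j i ∈ joinEdges T S ↔ i ∈ S j :=
  Finset.inr_mem_disjSum.trans (by simp)

theorem joinEdges_bijective : Function.Bijective
    fun p : Finset {f : G.E // f ≠ e} × ∀ j : Fin b.length, Finset (Fin (b.get j)) =>
      joinEdges p.1 p.2 := by
  classical
  constructor
  · rintro ⟨T, S⟩ ⟨T', S'⟩ h
    simp only [Finset.ext_iff] at h
    refine Prod.ext ?_ (funext fun j => ?_)
    · ext f
      simpa only [oldEdge_mem_joinEdges] using h (oldEdge f)
    · ext i
      simpa only [newEdge_mem_joinEdges] using h (newEdge j i)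
  · refine fun U => ⟨⟨Finset.univ.filter fun f => oldEdge f ∈ U,
      fun j => Finset.univ.filter fun i => newEdge j i ∈ U⟩, ?_⟩
    ext a
    induction a using edge_cases with
    | old f => simp [oldEdge_mem_joinEdges]
    | new j i => simp [newEdge_mem_joinEdges]

theorem baseEdges_joinEdges : baseEdges (joinEdges T S : Set (G.bananify e b).E) =
    Subtype.val '' (T : Set {f : G.E // f ≠ e}) := by
  ext a
  simp [baseEdges, oldEdge_mem_joinEdges]

open Classical in
theorem prod_bananify (g : (G.bananify e b).E → R) :
    ∏ a, g a = (∏ f, g (oldEdge f)) * ∏ j, ∏ i, g (newEdge j i) := by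
  refine (Fintype.prod_sum_type (α₁ := {f : G.E // f ≠ e})
    (α₂ := Σ j : Fin b.length, Fin (b.get j)) g).trans ?_
  rw [Fintype.prod_sigma]
  congr!

end Multigraph

namespace Multigraph

variable {R : Type*} [CommSemiring R] {G : Multigraph} {e : G.E} {b : List ℕ}

-- `isTree_bananify_iff` as an identity of indicators: each of the two terms separates into a factor
-- for the old edges and a factor for the choices inside the bananas, so that the two can be summed
-- independently.
open Classical in
theorem ite_isTree_joinEdges (hb : b ≠ []) (T : Finset {f : G.E // f ≠ e})
    (S : ∀ j : Fin b.length, Finset (Fin (b.get j))) (w v : R) :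
    (if (G.bananify e b).IsTree (joinEdges T S : Set (G.bananify e b).E) then w * v else 0) =
      (if G.IsTree (insert e (Subtype.val '' (T : Set {f // f ≠ e}))) then w else 0) *
        (if ∀ j, ∃! i, i ∈ S j then v else 0) +
      (if G.IsTree (Subtype.val '' (T : Set {f // f ≠ e})) then w else 0) *
        ∑ j, if ∀ k, if k = j then S k = ∅ else ∃! i, i ∈ S k then v else 0 := by
  have hQ : ∀ j, (¬ Meets (joinEdges T S : Set (G.bananify e b).E) j ∧
      ∀ k, k ≠ j → ∃! i, newEdge k i ∈ (joinEdges T S : Set (G.bananify e b).E)) ↔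
      ∀ k, if k = j then S k = ∅ else ∃! i, i ∈ S k := by
    intro j
    simp only [Meets, Finset.mem_coe, newEdge_mem_joinEdges]
    constructor
    · rintro ⟨h1, h2⟩ k
      split_ifs with hk
      · subst hk
        exact Finset.eq_empty_of_forall_notMem fun i hi => h1 ⟨i, hi⟩
      · exact h2 k hk
    · intro h
      refine ⟨?_, fun k hk => by simpa [hk] using h k⟩
      have := h j
      rw [if_pos rfl] at this
      simp [this]
  have htree := isTree_bananify_iff hb (joinEdges T S : Set (G.bananify e b).E)
  simp only [hQ, baseEdges_joinEdges] at htree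
  simp only [Finset.mem_coe, newEdge_mem_joinEdges] at htree
  rw [ite_or_exists htree]
  · rw [Finset.mul_sum]
    congr 1
    · split_ifs <;> simp
    · refine Finset.sum_congr rfl fun j _ => ?_
      split_ifs <;> simp
  · intro j h1 h2
    have := h2 j
    rw [if_pos rfl] at this
    simpa [this] using (h1 j).exists
  · intro j k h1 h2
    by_contra hne
    have h3 := h1 j
    have h4 := h2 j
    rw [if_pos rfl] at h3
    rw [if_neg hne] at h4
    simpa [h3] using h4.exists

open Classical in
/-- Bananification of an edge replaces its pair of weights in the tree sum by the weights of the
string of bananas. -/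
theorem treeSum_bananify (hb : b ≠ []) (A B : (G.bananify e b).E → R) (A₀ B₀ : G.E → R)
    (hA : ∀ f, A₀ f.1 = A (oldEdge f)) (hB : ∀ f, B₀ f.1 = B (oldEdge f))
    (hAe : A₀ e = ∏ j, seriesSum (B ∘ newEdge j) (A ∘ newEdge j) Finset.univ)
    (hBe : B₀ e = seriesSum (fun j => seriesSum (B ∘ newEdge j) (A ∘ newEdge j) Finset.univ)
      (fun j => ∏ i, B (newEdge j i)) Finset.univ) :
    (G.bananify e b).treeSum A B = G.treeSum A₀ B₀ := by
  rw [treeSum_eq, treeSum_split G e, ← joinEdges_bijective.sum_comp, Fintype.sum_prod_type,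
    Finset.sum_mul, Finset.sum_mul, ← Finset.sum_add_distrib]
  refine Finset.sum_congr rfl fun T _ => ?_
  have hterm : ∀ S : ∀ j, Finset (Fin (b.get j)),
      (∏ a, if a ∈ joinEdges T S then A a else B a) =
        (∏ a : {f // f ≠ e}, if a ∈ T then A₀ a else B₀ a) *
          ∏ j, ∏ i, if i ∈ S j then A (newEdge j i) else B (newEdge j i) := fun S => by
    rw [prod_bananify]
    simp only [oldEdge_mem_joinEdges, newEdge_mem_joinEdges, hA, hB]
  simp only [hterm, ite_isTree_joinEdges hb]
  rw [Finset.sum_add_distrib, ← Finset.mul_sum, ← Finset.mul_sum, Finset.sum_comm,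
    add_comm, hAe, hBe]
  -- The choices in one banana contribute in two ways: exactly one edge gives the `A` of the banana
  -- (`hone`), no edge gives its `B` (`hzero`).
  have hone : ∀ j, ∑ S : Finset (Fin (b.get j)), (if ∃! i, i ∈ S then
      ∏ i, if i ∈ S then A (newEdge j i) else B (newEdge j i) else 0) =
      seriesSum (B ∘ newEdge j) (A ∘ newEdge j) Finset.univ :=
    fun j => sum_existsUnique_mem (A ∘ newEdge j) (B ∘ newEdge j)
  have hzero : ∀ j, ∑ S : Finset (Fin (b.get j)), (if S = ∅ then
      ∏ i, if i ∈ S then A (newEdge j i) else B (newEdge j i) else 0) =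
      ∏ i, B (newEdge j i) := fun j => by
    simp
  congr 1
  · congr 1
    rw [seriesSum]
    refine Finset.sum_congr rfl fun j _ => ?_
    rw [sum_ite_forall_prod (α := fun j : Fin b.length => Finset (Fin (b.get j)))
      (fun k S => if k = j then S = ∅ else ∃! i, i ∈ S)
      (fun j S => ∏ i, if i ∈ S then A (newEdge j i) else B (newEdge j i)),
      ← Finset.mul_prod_erase _ _ (Finset.mem_univ j)]
    congr 1
    · simp only [if_true]
      exact hzero j
    · refine Finset.prod_congr rfl fun k hk => ?_
      simp only [Finset.ne_of_mem_erase hk, if_false]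
      exact hone k
  · rw [sum_ite_forall_prod (α := fun j : Fin b.length => Finset (Fin (b.get j)))
      (fun k S => ∃! i, i ∈ S)
      (fun j S => ∏ i, if i ∈ S then A (newEdge j i) else B (newEdge j i))]
    simp only [hone]

end Multigraph

/-! ### Classes of affine varieties -/

section affineClass

variable {K : Type u} [Field K]

open scoped TensorProduct

variable (K) in
/-- The spectrum of an algebra of finite type over `K`. -/
noncomputable def KVariety.spec (A : Type u) [CommRing A] [Algebra K A]
    [Algebra.FiniteType K A] : KVariety K where
  scheme := Spec (CommRingCat.of A)
  str := Spec.map (CommRingCat.ofHom (algebraMap K A))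
  locallyOfFiniteType := by
    rw [HasRingHomProperty.Spec_iff (P := @LocallyOfFiniteType)]
    exact (RingHom.finiteType_algebraMap).2 inferInstance
  quasiCompact := inferInstance
  isSeparated := inferInstance

variable (K) in
/-- The class of the spectrum of an algebra of finite type over `K`. -/
noncomputable def specClass (A : Type u) [CommRing A] [Algebra K A]
    [Algebra.FiniteType K A] : GrothendieckRing K :=
  (KVariety.spec K A).grothendieckClass

theorem KVariety.grothendieckClass_eq_of_iso {X Y : KVariety K} (φ : X.scheme ≅ Y.scheme)
    (hφ : φ.hom ≫ Y.str = X.str) : X.grothendieckClass = Y.grothendieckClass :=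
  RingQuot.mkRingHom_rel (.iso X Y φ hφ)

theorem SpecMap_algHom_comp {A B : Type u} [CommRing A] [Algebra K A]
    [CommRing B] [Algebra K B] (φ : A →ₐ[K] B) :
    Spec.map (CommRingCat.ofHom φ.toRingHom) ≫
      Spec.map (CommRingCat.ofHom (algebraMap K A)) =
    Spec.map (CommRingCat.ofHom (algebraMap K B)) := by
  rw [← Spec.map_comp, ← CommRingCat.ofHom_comp]
  congr 2
  exact φ.comp_algebraMap

variable {A B : Type u} [CommRing A] [Algebra K A] [Algebra.FiniteType K A]
  [CommRing B] [Algebra K B] [Algebra.FiniteType K B]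

theorem specClass_congr (φ : A ≃ₐ[K] B) : specClass K A = specClass K B := by
  refine KVariety.grothendieckClass_eq_of_iso
    (Scheme.Spec.mapIso φ.toRingEquiv.toCommRingCatIso.op).symm ?_
  exact SpecMap_algHom_comp (φ.symm : B →ₐ[K] A)

theorem specClass_field : specClass K K = 1 := by
  have h : IsIso (KVariety.spec K K).str := by
    have : (KVariety.spec K K).str = 𝟙 (Spec (CommRingCat.of K)) := Spec.map_id _
    rw [this]
    exact inferInstanceAs (IsIso (𝟙 (Spec (CommRingCat.of K))))
  exact (RingQuot.mkRingHom_rel (.point _ h)).trans (map_one _)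

instance : Algebra.FiniteType K (A ⊗[K] B) :=
  Algebra.FiniteType.trans (S := A) inferInstance inferInstance

theorem specClass_tensor : specClass K (A ⊗[K] B) = specClass K A * specClass K B := by
  refine (RingQuot.mkRingHom_rel (GrothendieckRel.prod (KVariety.spec K A) (KVariety.spec K B)
    (KVariety.spec K (A ⊗[K] B))
    (Spec.map (CommRingCat.ofHom Algebra.TensorProduct.includeLeftRingHom))
    (Spec.map (CommRingCat.ofHom Algebra.TensorProduct.includeRight.toRingHom)) ?_ ?_)).trans
    (map_mul _ _ _)
  · exact SpecMap_algHom_comp (Algebra.TensorProduct.includeLeft : A →ₐ[K] A ⊗[K] B)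
  · exact isPullback_SpecMap_of_isPushout _ _ _ _ (CommRingCat.isPushout_tensorProduct K A B)

/-- The scissor relation for the closed set `V(f)` and its complement `D(f)`, the images of the
spectra of the quotient and of the localization. -/
theorem specClass_scissor (f : A) :
    specClass K A = specClass K (A ⧸ Ideal.span {f}) + specClass K (Localization.Away f) := by
  refine (RingQuot.mkRingHom_rel (GrothendieckRel.scissor (KVariety.spec K A)
    (KVariety.spec K (A ⧸ Ideal.span {f})) (KVariety.spec K (Localization.Away f))
    (Spec.map (CommRingCat.ofHom (Ideal.Quotient.mkₐ K (Ideal.span {f})).toRingHom))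
    (Spec.map (CommRingCat.ofHom (algebraMap A (Localization.Away f)))) ?_ ?_ ?_ ?_ ?_)).trans
    (map_add _ _ _)
  · exact IsClosedImmersion.spec_of_surjective _ Ideal.Quotient.mk_surjective
  · exact inferInstanceAs
      (IsOpenImmersion (Spec.map (CommRingCat.ofHom (algebraMap A (Localization.Away f)))))
  · exact SpecMap_algHom_comp (Ideal.Quotient.mkₐ K (Ideal.span {f}))
  · exact SpecMap_algHom_comp (IsScalarTower.toAlgHom K A (Localization.Away f))
  · have h1 : Set.range (Spec.map (CommRingCat.ofHom (algebraMap A (Localization.Away f)))) =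
        (PrimeSpectrum.basicOpen f : Set (PrimeSpectrum A)) :=
      PrimeSpectrum.localization_away_comap_range _ _
    have h2 : Set.range (Spec.map (CommRingCat.ofHom
        (Ideal.Quotient.mkₐ K (Ideal.span {f})).toRingHom)) = PrimeSpectrum.zeroLocus {f} := by
      refine (range_comap_of_surjective _ (Ideal.Quotient.mk (Ideal.span {f}))
        Ideal.Quotient.mk_surjective).trans ?_
      exact (congrArg (fun I : Ideal A => PrimeSpectrum.zeroLocus (I : Set A))
        (Ideal.mk_ker (I := Ideal.span {f}))).trans (PrimeSpectrum.zeroLocus_span _)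
    refine h1.trans ?_
    rw [PrimeSpectrum.basicOpen_eq_zeroLocus_compl]
    exact congrArg _ h2.symm

theorem hypersurfaceComplement_class {ι : Type} [Finite ι] (F : MvPolynomial ι K) :
    (KVariety.hypersurfaceComplement F).grothendieckClass = specClass K (Localization.Away F) := by
  refine KVariety.grothendieckClass_eq_of_iso
    (basicOpenIsoSpecAway (R := CommRingCat.of (MvPolynomial ι K)) F) ?_
  have h := SpecMap_algHom_comp (IsScalarTower.toAlgHom K (MvPolynomial ι K) (Localization.Away F))
  refine (congrArg (fun t => _ ≫ t) h.symm).trans ?_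
  refine (Category.assoc _ _ _).symm.trans ?_
  exact congrArg (fun t => t ≫ _)
    (basicOpenIsoSpecAway_hom_SpecMap (R := CommRingCat.of (MvPolynomial ι K)) F)

end affineClass

/-! ### Loci in affine space and their functors of points -/

section locClass

open MvPolynomial
open scoped TensorProduct

variable {K : Type u} [Field K] {ι ι' ι₁ ι₂ : Type}

/-- `x` is a point, with coordinates in `R`, of the subscheme of affine space where the polynomials
in `I` vanish and `g` is invertible. -/
def IsPoint {R : Type u} [CommRing R] [Algebra K R] (I : Set (MvPolynomial ι K))
    (g : MvPolynomial ι K) (x : ι → R) : Prop :=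
  (∀ f ∈ I, aeval x f = 0) ∧ IsUnit (aeval x g)

theorem aeval_algHom_comp {R S : Type u} [CommRing R] [Algebra K R] [CommRing S] [Algebra K S]
    (φ : R →ₐ[K] S) (x : ι → R) (f : MvPolynomial ι K) : aeval (φ ∘ x) f = φ (aeval x f) :=
  (comp_aeval_apply x φ f).symm

theorem IsPoint.map {R S : Type u} [CommRing R] [Algebra K R] [CommRing S] [Algebra K S]
    {I : Set (MvPolynomial ι K)} {g : MvPolynomial ι K} {x : ι → R} (h : IsPoint I g x)
    (φ : R →ₐ[K] S) : IsPoint I g (φ ∘ x) := by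
  refine ⟨fun f hf => ?_, ?_⟩
  · rw [aeval_algHom_comp, h.1 f hf, map_zero]
  · rw [aeval_algHom_comp]
    exact h.2.map φ

/-- `A` is the coordinate ring of the subscheme of affine space where the polynomials in `I` vanish
and `g` is invertible, with coordinate functions `ξ`. -/
structure IsCoordinateRing (I : Set (MvPolynomial ι K)) (g : MvPolynomial ι K) (A : Type u)
    [CommRing A] [Algebra K A] (ξ : ι → A) : Prop where
  isPoint : IsPoint I g ξ
  lift : ∀ {R : Type u} [CommRing R] [Algebra K R] (x : ι → R), IsPoint I g x →
    ∃ φ : A →ₐ[K] R, φ ∘ ξ = x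
  ext : ∀ {R : Type u} [CommRing R] [Algebra K R] (φ ψ : A →ₐ[K] R), φ ∘ ξ = ψ ∘ ξ → φ = ψ

/-- A correspondence that is bijective on points gives an equality of classes. -/
theorem IsCoordinateRing.specClass_eq {I : Set (MvPolynomial ι K)} {g : MvPolynomial ι K}
    {I' : Set (MvPolynomial ι' K)} {g' : MvPolynomial ι' K} {A A' : Type u} [CommRing A]
    [Algebra K A] [Algebra.FiniteType K A] [CommRing A'] [Algebra K A'] [Algebra.FiniteType K A']
    {ξ : ι → A} {ξ' : ι' → A'} (hA : IsCoordinateRing I g A ξ) (hA' : IsCoordinateRing I' g' A' ξ')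
    (r : ∀ {R : Type u} [CommRing R] [Algebra K R], (ι → R) → (ι' → R) → Prop)
    (hmap : ∀ {R S : Type u} [CommRing R] [Algebra K R] [CommRing S] [Algebra K S]
      (φ : R →ₐ[K] S) (x : ι → R) (y : ι' → R), r x y → r (φ ∘ x) (φ ∘ y))
    (hex : ∀ {R : Type u} [CommRing R] [Algebra K R] (x : ι → R), IsPoint I g x →
      ∃ y, IsPoint I' g' y ∧ r x y)
    (hex' : ∀ {R : Type u} [CommRing R] [Algebra K R] (y : ι' → R), IsPoint I' g' y →
      ∃ x, IsPoint I g x ∧ r x y)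
    (huniq : ∀ {R : Type u} [CommRing R] [Algebra K R] (x : ι → R) (y y' : ι' → R),
      IsPoint I g x → IsPoint I' g' y → IsPoint I' g' y' → r x y → r x y' → y = y')
    (huniq' : ∀ {R : Type u} [CommRing R] [Algebra K R] (x x' : ι → R) (y : ι' → R),
      IsPoint I g x → IsPoint I g x' → IsPoint I' g' y → r x y → r x' y → x = x') :
    specClass K A = specClass K A' := by
  -- The Yoneda argument: the partners of the two universal points `ξ` and `ξ'` define homomorphisms
  -- in both directions. Naturality of `r` and uniqueness of partners show that the composites fix
  -- the universal points, hence are identities.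
  obtain ⟨y, hy, hr⟩ := hex ξ hA.isPoint
  obtain ⟨φ, hφ⟩ := hA'.lift y hy
  obtain ⟨x, hx, hr'⟩ := hex' ξ' hA'.isPoint
  obtain ⟨ψ, hψ⟩ := hA.lift x hx
  refine specClass_congr (AlgEquiv.ofAlgHom ψ φ ?_ ?_)
  · refine hA'.ext _ _ ?_
    have h1 : (ψ.comp φ) ∘ ξ' = ψ ∘ y := by
      rw [← hφ]; rfl
    have h2 := hmap ψ _ _ hr
    rw [hψ] at h2
    exact h1.trans (huniq x _ _ hx (hy.map ψ) hA'.isPoint h2 hr')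
  · refine hA.ext _ _ ?_
    have h1 : (φ.comp ψ) ∘ ξ = φ ∘ x := by
      rw [← hψ]; rfl
    have h2 := hmap φ _ _ hr'
    rw [hφ] at h2
    exact h1.trans (huniq' _ _ y (hx.map φ) hA.isPoint hy h2 hr)

theorem isCoordinateRing_localization_quotient (I : Set (MvPolynomial ι K))
    (g : MvPolynomial ι K) :
    IsCoordinateRing I g (Localization.Away (Ideal.Quotient.mk (Ideal.span I) g))
      (fun i => algebraMap _ _ (Ideal.Quotient.mk (Ideal.span I) (X i))) := by
  set Q := MvPolynomial ι K ⧸ Ideal.span I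
  set L := Localization.Away (Ideal.Quotient.mk (Ideal.span I) g)
  have key : ∀ f : MvPolynomial ι K,
      aeval (fun i => algebraMap Q L (Ideal.Quotient.mk (Ideal.span I) (X i))) f =
        algebraMap Q L (Ideal.Quotient.mk (Ideal.span I) f) := fun f =>
    (DFunLike.congr_fun (aeval_unique
      ((IsScalarTower.toAlgHom K Q L).comp (Ideal.Quotient.mkₐ K (Ideal.span I)))) f).symm
  refine ⟨⟨fun f hf => ?_, ?_⟩, fun {R} _ _ x hx => ?_, fun {R} _ _ φ ψ h => ?_⟩
  · rw [key, Ideal.Quotient.eq_zero_iff_mem.2 (Ideal.subset_span hf), map_zero]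
  · rw [key]
    exact IsLocalization.Away.algebraMap_isUnit _
  · have h0 : ∀ a ∈ Ideal.span I, aeval x a = 0 := fun a ha => by
      have : Ideal.span I ≤ RingHom.ker (aeval x : MvPolynomial ι K →ₐ[K] R) :=
        Ideal.span_le.2 hx.1
      exact this ha
    have hu : ∀ y : Submonoid.powers (Ideal.Quotient.mk (Ideal.span I) g),
        IsUnit (Ideal.Quotient.liftₐ (Ideal.span I) (aeval x) h0 y) := by
      rintro ⟨_, n, rfl⟩
      rw [map_pow]
      exact hx.2.pow n
    refine ⟨IsLocalization.liftAlgHom (S := L)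
      (f := Ideal.Quotient.liftₐ (Ideal.span I) (aeval x) h0) hu, funext fun i => ?_⟩
    refine (IsLocalization.lift_eq _ _).trans ?_
    exact aeval_X _ _
  · refine IsLocalization.algHom_ext (Submonoid.powers (Ideal.Quotient.mk (Ideal.span I) g)) ?_
    refine Ideal.Quotient.algHom_ext _ ?_
    refine MvPolynomial.algHom_ext fun i => congrFun h i

theorem IsCoordinateRing.quotient {I : Set (MvPolynomial ι K)} {g : MvPolynomial ι K}
    {A : Type u} [CommRing A] [Algebra K A] {ξ : ι → A} (hA : IsCoordinateRing I g A ξ)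
    (f : MvPolynomial ι K) :
    IsCoordinateRing (insert f I) g (A ⧸ Ideal.span {aeval ξ f})
      (Ideal.Quotient.mkₐ K (Ideal.span {aeval ξ f}) ∘ ξ) := by
  have hp := hA.isPoint.map (Ideal.Quotient.mkₐ K (Ideal.span {aeval ξ f}))
  refine ⟨⟨?_, hp.2⟩, fun {R} _ _ x hx => ?_, fun {R} _ _ φ ψ h => ?_⟩
  · rintro f' (rfl | hf')
    · rw [aeval_algHom_comp]
      exact Ideal.Quotient.eq_zero_iff_mem.2 (Ideal.mem_span_singleton_self _)
    · exact hp.1 f' hf'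
  · obtain ⟨φ, rfl⟩ := hA.lift x ⟨fun f' hf' => hx.1 f' (Set.mem_insert_of_mem _ hf'), hx.2⟩
    have h0 : φ (aeval ξ f) = 0 := by
      rw [comp_aeval_apply]
      exact hx.1 f (Set.mem_insert _ _)
    refine ⟨Ideal.Quotient.liftₐ _ φ fun a ha => ?_, rfl⟩
    have : Ideal.span {aeval ξ f} ≤ RingHom.ker φ := by simpa [Ideal.span_le] using h0
    exact this ha
  · exact Ideal.Quotient.algHom_ext _ (hA.ext _ _ h)

theorem IsCoordinateRing.localization {I : Set (MvPolynomial ι K)} {g : MvPolynomial ι K}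
    {A : Type u} [CommRing A] [Algebra K A] {ξ : ι → A} (hA : IsCoordinateRing I g A ξ)
    (f : MvPolynomial ι K) :
    IsCoordinateRing I (g * f) (Localization.Away (aeval ξ f))
      (IsScalarTower.toAlgHom K A (Localization.Away (aeval ξ f)) ∘ ξ) := by
  have hp := hA.isPoint.map (IsScalarTower.toAlgHom K A (Localization.Away (aeval ξ f)))
  refine ⟨⟨hp.1, ?_⟩, fun {R} _ _ x hx => ?_, fun {R} _ _ φ ψ h => ?_⟩
  · rw [map_mul]
    refine hp.2.mul ?_
    rw [aeval_algHom_comp]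
    exact IsLocalization.Away.algebraMap_isUnit _
  · have hx2 := hx.2
    rw [map_mul, IsUnit.mul_iff] at hx2
    obtain ⟨φ, rfl⟩ := hA.lift x ⟨hx.1, hx2.1⟩
    have hu : ∀ y : Submonoid.powers (aeval ξ f), IsUnit (φ y) := by
      rintro ⟨_, n, rfl⟩
      rw [map_pow, comp_aeval_apply]
      exact hx2.2.pow n
    exact ⟨IsLocalization.liftAlgHom (S := Localization.Away (aeval ξ f)) (f := φ) hu,
      funext fun i => IsLocalization.lift_eq _ _⟩
  · exact IsLocalization.algHom_ext (Submonoid.powers (aeval ξ f)) (hA.ext _ _ h)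

theorem IsCoordinateRing.tensor {I₁ : Set (MvPolynomial ι₁ K)} {g₁ : MvPolynomial ι₁ K}
    {I₂ : Set (MvPolynomial ι₂ K)} {g₂ : MvPolynomial ι₂ K} {A₁ A₂ : Type u} [CommRing A₁]
    [Algebra K A₁] {ξ₁ : ι₁ → A₁} (h₁ : IsCoordinateRing I₁ g₁ A₁ ξ₁) [CommRing A₂]
    [Algebra K A₂] {ξ₂ : ι₂ → A₂} (h₂ : IsCoordinateRing I₂ g₂ A₂ ξ₂)
    {I : Set (MvPolynomial (ι₁ ⊕ ι₂) K)} {g : MvPolynomial (ι₁ ⊕ ι₂) K}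
    (h : ∀ {R : Type u} [CommRing R] [Algebra K R] (x : ι₁ → R) (y : ι₂ → R),
      IsPoint I g (Sum.elim x y) ↔ IsPoint I₁ g₁ x ∧ IsPoint I₂ g₂ y) :
    IsCoordinateRing I g (A₁ ⊗[K] A₂)
      (Sum.elim ((Algebra.TensorProduct.includeLeft : A₁ →ₐ[K] A₁ ⊗[K] A₂) ∘ ξ₁)
        ((Algebra.TensorProduct.includeRight : A₂ →ₐ[K] A₁ ⊗[K] A₂) ∘ ξ₂)) := by
  refine ⟨(h _ _).2 ⟨h₁.isPoint.map _, h₂.isPoint.map _⟩, fun {R} _ _ x hx => ?_,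
    fun {R} _ _ φ ψ hφ => ?_⟩
  · obtain ⟨x, y, rfl⟩ : ∃ x₁ x₂, x = Sum.elim x₁ x₂ :=
      ⟨x ∘ Sum.inl, x ∘ Sum.inr, (Sum.elim_comp_inl_inr x).symm⟩
    obtain ⟨hx1, hx2⟩ := (h _ _).1 hx
    obtain ⟨φ₁, rfl⟩ := h₁.lift _ hx1
    obtain ⟨φ₂, rfl⟩ := h₂.lift _ hx2
    refine ⟨Algebra.TensorProduct.productMap φ₁ φ₂, ?_⟩
    ext (i | i) <;> simp
  · refine Algebra.TensorProduct.ext ?_ ?_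
    · exact h₁.ext _ _ (funext fun i => congrFun hφ (Sum.inl i))
    · exact h₂.ext _ _ (funext fun i => congrFun hφ (Sum.inr i))

variable [Finite ι] [Finite ι'] [Finite ι₁] [Finite ι₂]

/-- The class of the subscheme of affine space where the polynomials in `I` vanish and `g` is
invertible. -/
noncomputable def locClass (I : Set (MvPolynomial ι K)) (g : MvPolynomial ι K) :
    GrothendieckRing K :=
  specClass K (Localization.Away (Ideal.Quotient.mk (Ideal.span I) g))

theorem locClass_eq_of_rel {I : Set (MvPolynomial ι K)} {g : MvPolynomial ι K}
    {I' : Set (MvPolynomial ι' K)} {g' : MvPolynomial ι' K}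
    (r : ∀ {R : Type u} [CommRing R] [Algebra K R], (ι → R) → (ι' → R) → Prop)
    (hmap : ∀ {R S : Type u} [CommRing R] [Algebra K R] [CommRing S] [Algebra K S]
      (φ : R →ₐ[K] S) (x : ι → R) (y : ι' → R), r x y → r (φ ∘ x) (φ ∘ y))
    (hex : ∀ {R : Type u} [CommRing R] [Algebra K R] (x : ι → R), IsPoint I g x →
      ∃ y, IsPoint I' g' y ∧ r x y)
    (hex' : ∀ {R : Type u} [CommRing R] [Algebra K R] (y : ι' → R), IsPoint I' g' y →
      ∃ x, IsPoint I g x ∧ r x y)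
    (huniq : ∀ {R : Type u} [CommRing R] [Algebra K R] (x : ι → R) (y y' : ι' → R),
      IsPoint I g x → IsPoint I' g' y → IsPoint I' g' y' → r x y → r x y' → y = y')
    (huniq' : ∀ {R : Type u} [CommRing R] [Algebra K R] (x x' : ι → R) (y : ι' → R),
      IsPoint I g x → IsPoint I g x' → IsPoint I' g' y → r x y → r x' y → x = x') :
    locClass I g = locClass I' g' :=
  (isCoordinateRing_localization_quotient I g).specClass_eq
    (isCoordinateRing_localization_quotient I' g') r hmap hex hex' huniq huniq'

/-- A bijection on points that permutes the coordinates gives an equality of classes. -/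
theorem locClass_reindex {I : Set (MvPolynomial ι K)} {g : MvPolynomial ι K}
    {I' : Set (MvPolynomial ι' K)} {g' : MvPolynomial ι' K} (σ : ι ≃ ι')
    (h : ∀ {R : Type u} [CommRing R] [Algebra K R] (x : ι' → R),
      IsPoint I g (x ∘ σ) ↔ IsPoint I' g' x) :
    locClass I g = locClass I' g' := by
  refine locClass_eq_of_rel (fun x y => x = y ∘ σ) ?_ ?_ ?_ ?_ ?_
  · rintro R S _ _ _ _ φ x y rfl
    rfl
  · intro R _ _ x hx
    have hσ : (x ∘ σ.symm) ∘ σ = x := by simp [Function.comp_assoc]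
    exact ⟨x ∘ σ.symm, (h _).1 (hσ.symm ▸ hx), hσ.symm⟩
  · exact fun y hy => ⟨y ∘ σ, (h y).2 hy, rfl⟩
  · rintro R _ _ x y y' - - - rfl h
    exact σ.surjective.injective_comp_right h
  · rintro R _ _ x x' y - - - rfl rfl
    rfl

theorem locClass_congr {I I' : Set (MvPolynomial ι K)} {g g' : MvPolynomial ι K}
    (h : ∀ {R : Type u} [CommRing R] [Algebra K R] (x : ι → R),
      IsPoint I g x ↔ IsPoint I' g' x) :
    locClass I g = locClass I' g' :=
  locClass_reindex (Equiv.refl ι) h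

/-- The class does not depend on the model of the coordinate ring, so quotients, localizations and
tensor products of models can be used as they stand. -/
theorem IsCoordinateRing.locClass_eq {I : Set (MvPolynomial ι K)} {g : MvPolynomial ι K}
    {A : Type u} [CommRing A] [Algebra K A] [Algebra.FiniteType K A] {ξ : ι → A}
    (hA : IsCoordinateRing I g A ξ) : locClass I g = specClass K A := by
  refine (isCoordinateRing_localization_quotient I g).specClass_eq hA (fun x y => x = y)
    ?_ ?_ ?_ ?_ ?_
  · rintro R S _ _ _ _ φ x y rfl
    rfl
  · exact fun x hx => ⟨x, hx, rfl⟩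
  · exact fun y hy => ⟨y, hy, rfl⟩
  · rintro R _ _ x y y' - - - rfl rfl
    rfl
  · rintro R _ _ x x' y - - - rfl rfl
    rfl

/-- Over a general `K`-algebra a value of `f` need be neither zero nor invertible, so case
distinctions cannot be made on points. This relation makes them on the level of classes. -/
theorem locClass_scissor (I : Set (MvPolynomial ι K)) (g f : MvPolynomial ι K) :
    locClass I g = locClass (insert f I) g + locClass I (g * f) := by
  have h := isCoordinateRing_localization_quotient I g
  rw [(h.quotient f).locClass_eq, (h.localization f).locClass_eq]
  exact specClass_scissor _

theorem locClass_mul {I₁ : Set (MvPolynomial ι₁ K)} {g₁ : MvPolynomial ι₁ K}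
    {I₂ : Set (MvPolynomial ι₂ K)} {g₂ : MvPolynomial ι₂ K}
    {I : Set (MvPolynomial (ι₁ ⊕ ι₂) K)} {g : MvPolynomial (ι₁ ⊕ ι₂) K}
    (h : ∀ {R : Type u} [CommRing R] [Algebra K R] (x : ι₁ → R) (y : ι₂ → R),
      IsPoint I g (Sum.elim x y) ↔ IsPoint I₁ g₁ x ∧ IsPoint I₂ g₂ y) :
    locClass I g = locClass I₁ g₁ * locClass I₂ g₂ := by
  rw [((isCoordinateRing_localization_quotient I₁ g₁).tensor
    (isCoordinateRing_localization_quotient I₂ g₂) h).locClass_eq]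
  exact specClass_tensor

/-- Cut along `f = 1`. The equation `1 = 0` already holds at every point, and inverting `1` changes
nothing, so the class `c` satisfies `c = c + c`. -/
theorem locClass_eq_zero {I : Set (MvPolynomial ι K)} {g : MvPolynomial ι K}
    (h : ∀ {R : Type u} [CommRing R] [Algebra K R] (x : ι → R), IsPoint I g x → (1 : R) = 0) :
    locClass I g = 0 := by
  have h1 := locClass_scissor I g 1
  have h2 : locClass (insert 1 I) g = locClass I g := locClass_congr fun {R} _ _ x => by
    refine ⟨fun hx => ⟨fun f hf => hx.1 f (Set.mem_insert_of_mem _ hf), hx.2⟩, fun hx => ?_⟩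
    have : Subsingleton R := subsingleton_of_zero_eq_one (h x hx).symm
    exact ⟨fun f _ => Subsingleton.elim _ _, hx.2⟩
  rw [mul_one, h2] at h1
  simpa using h1

theorem hypersurfaceComplement_eq_locClass (F : MvPolynomial ι K) :
    (KVariety.hypersurfaceComplement F).grothendieckClass = locClass ∅ F := by
  have h : IsCoordinateRing (∅ : Set (MvPolynomial ι K)) 1 (MvPolynomial ι K) X :=
    by
    refine ⟨⟨by simp, by simp⟩, fun x _ => ⟨aeval x, funext fun i => ?_⟩, fun φ ψ h => ?_⟩
    · rw [Function.comp_apply, aeval_X]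
    · refine MvPolynomial.algHom_ext fun i => ?_
      have := congrFun h i
      rwa [Function.comp_apply, Function.comp_apply] at this
  have h' := (h.localization F).locClass_eq
  -- The model inverts the value of `F` at the universal point, `aeval X F`, which has to be
  -- identified with `F`.
  have hX : ∀ F' : MvPolynomial ι K, F' = F →
      specClass K (Localization.Away F') = specClass K (Localization.Away F) := by
    rintro _ rfl
    rfl
  rw [one_mul, hX _ (aeval_X_left_apply F)] at h'
  rw [h', hypersurfaceComplement_class]

end locClass

/-! ### The projective line minus three points as an affine curve -/

section projectiveLine

open MvPolynomial

theorem aeval_smul_of_isHomogeneous {σ R S : Type*} [Fintype σ] [CommSemiring R]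
    [CommSemiring S] [Algebra R S] {P : MvPolynomial σ R} {d : ℕ} (hP : P.IsHomogeneous d) (c : S)
    (x : σ → S) : MvPolynomial.aeval (c • x) P = c ^ d * MvPolynomial.aeval x P := by
  rw [aeval_def, eval₂_eq', aeval_def, eval₂_eq', Finset.mul_sum]
  refine Finset.sum_congr rfl fun m hm => ?_
  simp only [Pi.smul_apply, smul_eq_mul, mul_pow, Finset.prod_mul_distrib,
    Finset.prod_pow_eq_pow_sum]
  have hd : d = ∑ i, m i := (hP.degree_eq_sum_deg_support hm).trans
    (Finset.sum_subset (Finset.subset_univ _) fun i _ hi => by simpa using hi)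
  rw [hd]
  ring

variable {K : Type u} [Field K]

variable (K) in
/-- The equation `X₀ X₁ (X₀ - X₁)` of the three points `0, 1, ∞` of the projective line. -/
noncomputable abbrev threePoints : MvPolynomial (Fin 2) K := X 0 * X 1 * (X 0 - X 1)

variable (K) in
/-- The equation `t (t - 1)` of the two points `0, 1` of the affine line. -/
noncomputable abbrev twoPoints : MvPolynomial Unit K := X () * (X () - 1)

variable (K) in
theorem threePoints_mem : threePoints K ∈ homogeneousSubmodule (Fin 2) K 3 :=
  ((isHomogeneous_X _ _).mul (isHomogeneous_X _ _)).mul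
    ((isHomogeneous_X _ _).sub (isHomogeneous_X _ _))

variable (K) in
/-- Dehomogenization, with values in `K[t, 1 / (t (t - 1))]`. -/
noncomputable def dehomogenize : MvPolynomial (Fin 2) K →ₐ[K] Localization.Away (twoPoints K) :=
  (IsScalarTower.toAlgHom K (MvPolynomial Unit K) (Localization.Away (twoPoints K))).comp
    (aeval ![X (), 1])

theorem dehomogenize_apply (P : MvPolynomial (Fin 2) K) :
    dehomogenize K P = algebraMap _ _ (aeval ![X (), 1] P : MvPolynomial Unit K) := rfl

theorem dehomogenize_threePoints :
    dehomogenize K (threePoints K) = algebraMap _ _ (twoPoints K) := by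
  rw [dehomogenize_apply]
  simp [threePoints, twoPoints]

variable (K) in
theorem isUnit_dehomogenize_threePoints : IsUnit ((dehomogenize K).toRingHom (threePoints K)) := by
  change IsUnit (dehomogenize K (threePoints K))
  rw [dehomogenize_threePoints]
  exact IsLocalization.Away.algebraMap_isUnit _

variable (K) in
/-- The coordinate ring of the complement of three points in the projective line maps to
`K[t, 1 / (t (t - 1))]`. -/
noncomputable def awayThreePointsHom :
    HomogeneousLocalization.Away (homogeneousSubmodule (Fin 2) K) (threePoints K) →+*
      Localization.Away (twoPoints K) :=
  (IsLocalization.Away.lift (S := Localization.Away (threePoints K)) (threePoints K)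
    (isUnit_dehomogenize_threePoints K)).comp (algebraMap _ _)

/-- The value of the map at `P / (X₀ X₁ (X₀ - X₁)) ^ n`, with the denominator cleared. -/
theorem awayThreePointsHom_mk (n : ℕ) (P : MvPolynomial (Fin 2) K)
    (hP : P ∈ homogeneousSubmodule (Fin 2) K (n • 3)) :
    awayThreePointsHom K (HomogeneousLocalization.Away.mk _ (threePoints_mem K) n P hP) *
      algebraMap _ _ (twoPoints K) ^ n = dehomogenize K P := by
  have h : (Localization.mk P ⟨threePoints K ^ n, n, rfl⟩ : Localization.Away (threePoints K)) *
      algebraMap _ (Localization.Away (threePoints K)) (threePoints K) ^ n =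
        algebraMap _ _ P := by
    rw [← map_pow, Localization.mk_eq_mk']
    exact IsLocalization.mk'_spec _ P (⟨threePoints K ^ n, n, rfl⟩ : Submonoid.powers _)
  have h' := congrArg (IsLocalization.Away.lift (S := Localization.Away (threePoints K))
    (threePoints K) (isUnit_dehomogenize_threePoints K)) h
  rw [map_mul, map_pow, IsLocalization.Away.lift_eq, IsLocalization.Away.lift_eq] at h'
  rw [← dehomogenize_threePoints]
  exact h'

/-- A homogeneous polynomial is recovered from its dehomogenization in the fraction field: `P(x₀,
x₁) = x₁ ^ d P(x₀ / x₁, 1)`. -/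
theorem eq_zero_of_dehomogenize_eq_zero {P : MvPolynomial (Fin 2) K} {d : ℕ}
    (hP : P.IsHomogeneous d) (h : dehomogenize K P = 0) : P = 0 := by
  have hX : (X () : MvPolynomial Unit K) - 1 ≠ 0 := by
    intro h
    have := congrArg (aeval (R := K) (fun _ : Unit => (0 : K))) h
    simp at this
  have hF : twoPoints K ≠ 0 := mul_ne_zero (X_ne_zero _) hX
  rw [dehomogenize_apply] at h
  have h0 : (aeval ![X (), 1] P : MvPolynomial Unit K) = 0 :=
    IsLocalization.injective (Localization.Away (twoPoints K))
      (powers_le_nonZeroDivisors_of_noZeroDivisors hF) (h.trans (map_zero _).symm)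
  set L := FractionRing (MvPolynomial (Fin 2) K)
  set x : Fin 2 → L := fun i => algebraMap (MvPolynomial (Fin 2) K) L (X i)
  have hinj := IsFractionRing.injective (MvPolynomial (Fin 2) K) L
  have hx1 : x 1 ≠ 0 := fun h => X_ne_zero (R := K) (1 : Fin 2)
    (hinj (h.trans (map_zero _).symm))
  have h1 : aeval ![x 0 / x 1, 1] P = 0 := by
    have := congrArg (aeval (R := K) (fun _ : Unit => x 0 / x 1)) h0
    rw [map_zero, comp_aeval_apply] at this
    rw [← this]
    congr 2
    funext i
    fin_cases i <;> simp
  have h2 : aeval x P = 0 := by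
    have : x = x 1 • ![x 0 / x 1, 1] := by
      funext i
      fin_cases i
      · simp [mul_div_cancel₀ _ hx1]
      · simp
    rw [this, aeval_smul_of_isHomogeneous hP, h1, mul_zero]
  refine hinj ?_
  rw [map_zero, ← h2]
  exact DFunLike.congr_fun (aeval_unique
    (IsScalarTower.toAlgHom K (MvPolynomial (Fin 2) K) L)) P

theorem awayThreePointsHom_injective : Function.Injective (awayThreePointsHom K) := by
  rw [injective_iff_map_eq_zero]
  intro z hz
  obtain ⟨n, P, hP, rfl⟩ := HomogeneousLocalization.Away.mk_surjective _ (threePoints_mem K) z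
  have h := awayThreePointsHom_mk n P hP
  rw [hz, zero_mul] at h
  obtain rfl := eq_zero_of_dehomogenize_eq_zero hP h.symm
  apply HomogeneousLocalization.val_injective
  rw [HomogeneousLocalization.Away.val_mk, HomogeneousLocalization.val_zero, Localization.mk_zero]

theorem awayThreePointsHom_algebraMap (c : K) :
    awayThreePointsHom K (HomogeneousLocalization.fromZeroRingHom _ _
      (algebraMap K (homogeneousSubmodule (Fin 2) K 0) c)) = algebraMap K _ c := by
  have h := awayThreePointsHom_mk 0 (C c) (isHomogeneous_C _ c)
  rw [pow_zero, mul_one] at h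
  have h2 : dehomogenize K (C c) = algebraMap K _ c := (dehomogenize K).commutes c
  rw [← h2, ← h]
  congr 1

theorem awayThreePointsHom_surjective : Function.Surjective (awayThreePointsHom K) := by
  have hu : IsUnit (algebraMap _ (Localization.Away (twoPoints K)) (twoPoints K)) :=
    IsLocalization.Away.algebraMap_isUnit _
  -- The preimage of `1 / (t (t - 1))` is `X₁³ / (X₀ X₁ (X₀ - X₁))`.
  have hinv : ∃ z, awayThreePointsHom K z * algebraMap _ _ (twoPoints K) = 1 := by
    have h := awayThreePointsHom_mk 1 (X 1 ^ 3 : MvPolynomial (Fin 2) K)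
      (by simpa using isHomogeneous_X_pow (R := K) (1 : Fin 2) 3)
    rw [pow_one] at h
    refine ⟨_, h.trans ?_⟩
    rw [dehomogenize_apply]
    simp
  -- The preimage of `t` is `X₀ / X₁`, written as `X₀² (X₀ - X₁)` over the common denominator.
  have hX : ∃ z, awayThreePointsHom K z = algebraMap _ _ (X () : MvPolynomial Unit K) := by
    have h := awayThreePointsHom_mk 1 (X 0 * X 0 * (X 0 - X 1) : MvPolynomial (Fin 2) K)
      (((isHomogeneous_X _ _).mul (isHomogeneous_X _ _)).mul
        ((isHomogeneous_X _ _).sub (isHomogeneous_X _ _)))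
    refine ⟨_, hu.mul_right_cancel (a := awayThreePointsHom K (HomogeneousLocalization.Away.mk _
      (threePoints_mem K) 1 _ (((isHomogeneous_X K 0).mul (isHomogeneous_X _ 0)).mul
        ((isHomogeneous_X _ 0).sub (isHomogeneous_X _ 1))))) ?_⟩
    rw [pow_one] at h
    rw [h, dehomogenize_apply, ← map_mul]
    congr 1
    simp [twoPoints]
    ring
  have hpoly : ∀ P : MvPolynomial Unit K, ∃ z, awayThreePointsHom K z = algebraMap _ _ P := by
    intro P
    induction P using MvPolynomial.induction_on with
    | C c => exact ⟨_, awayThreePointsHom_algebraMap c⟩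
    | add P Q hP hQ =>
      obtain ⟨z, hz⟩ := hP
      obtain ⟨w, hw⟩ := hQ
      exact ⟨z + w, by rw [map_add, map_add, hz, hw]⟩
    | mul_X P i hP =>
      obtain ⟨z, hz⟩ := hP
      obtain ⟨w, hw⟩ := hX
      exact ⟨z * w, by rw [map_mul, map_mul, hz, hw]⟩
  intro b
  obtain ⟨n, P, h⟩ := IsLocalization.Away.surj (twoPoints K) b
  obtain ⟨z, hz⟩ := hpoly P
  obtain ⟨w, hw⟩ := hinv
  refine ⟨z * w ^ n, ?_⟩
  rw [map_mul, map_pow, hz, ← h, mul_assoc, ← mul_pow, mul_comm _ (awayThreePointsHom K w), hw,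
    one_pow, mul_one]

/-- The basic open set of `Proj` is the spectrum of the degree-zero part of the localization, which
dehomogenization identifies with `K[t, 1 / (t (t - 1))]`. The rest of the argument checks that this
isomorphism is over `K`. -/
theorem threePointClass_eq_locClass : threePointClass K = locClass ∅ (twoPoints K) := by
  rw [← hypersurfaceComplement_eq_locClass, hypersurfaceComplement_class]
  set e := RingEquiv.ofBijective (awayThreePointsHom K)
    ⟨awayThreePointsHom_injective, awayThreePointsHom_surjective⟩
  set i := Proj.basicOpenIsoSpec (homogeneousSubmodule (Fin 2) K) (threePoints K)
    (threePoints_mem K) (by norm_num)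
  refine KVariety.grothendieckClass_eq_of_iso
    (i ≪≫ (Scheme.Spec.mapIso e.toCommRingCatIso.op).symm) ?_
  have h1 : e.symm.toRingHom.comp (algebraMap K (Localization.Away (twoPoints K))) =
      (HomogeneousLocalization.fromZeroRingHom (homogeneousSubmodule (Fin 2) K)
        (Submonoid.powers (threePoints K))).comp
        (algebraMap K (homogeneousSubmodule (Fin 2) K 0)) := by
    ext1 c
    refine e.symm_apply_eq.2 ?_
    exact (awayThreePointsHom_algebraMap c).symm
  have h2 : Spec.map (CommRingCat.ofHom e.symm.toRingHom) ≫
      Spec.map (CommRingCat.ofHom (algebraMap K (Localization.Away (twoPoints K)))) =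
      Proj.awayι (homogeneousSubmodule (Fin 2) K) (threePoints K)
        (threePoints_mem K) (by norm_num) ≫ Proj.toSpecZero _ ≫ Spec.map (CommRingCat.ofHom
          (algebraMap K (homogeneousSubmodule (Fin 2) K 0))) := by
    rw [Proj.awayι_toSpecZero_assoc, ← Spec.map_comp, ← Spec.map_comp, ← CommRingCat.ofHom_comp,
      ← CommRingCat.ofHom_comp, h1]
  have h3 : i.hom ≫ Proj.awayι (homogeneousSubmodule (Fin 2) K) (threePoints K)
      (threePoints_mem K) (by norm_num) = Scheme.Opens.ι _ := by
    rw [← Proj.basicOpenIsoSpec_inv_ι, Iso.hom_inv_id_assoc]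
  have h4 := congrArg (fun t => i.hom ≫ t) h2
  simp only [← Category.assoc, h3] at h4
  refine Eq.trans ?_ (h4.trans (Category.assoc _ _ _))
  rfl

end projectiveLine

/-! ### The classes of `𝔾ₘ` and `𝔸¹`, and the semiring generated by `𝕊` -/

section lefschetz

open MvPolynomial

variable {K : Type u} [Field K]

/-- A locus whose only point over every algebra is the fixed rational point `c` has coordinate ring
`K`. -/
theorem locClass_eq_one {ι : Type} [Finite ι] {I : Set (MvPolynomial ι K)} {g : MvPolynomial ι K}
    (c : ι → K) (h : ∀ {R : Type u} [CommRing R] [Algebra K R] (x : ι → R),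
      IsPoint I g x ↔ x = algebraMap K R ∘ c) : locClass I g = 1 := by
  have hc : IsCoordinateRing I g K c :=
    ⟨(h c).2 rfl, fun {R} _ _ x hx => ⟨Algebra.ofId K R, ((h x).1 hx).symm⟩,
      fun φ ψ _ => Subsingleton.elim _ _⟩
  rw [hc.locClass_eq, specClass_field]

variable (K) in
/-- The class of the affine line without the origin. -/
noncomputable def torusClass : GrothendieckRing K :=
  locClass ∅ (X () : MvPolynomial Unit K)

-- Remove the point `1` from `𝔾ₘ`.
variable (K) in
theorem torusClass_eq : torusClass K = threePointClass K + 1 := by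
  have h : locClass {(X () - 1 : MvPolynomial Unit K)} (X ()) = 1 :=
    locClass_eq_one 1 fun {R} _ _ x => by
      constructor
      · rintro ⟨h, -⟩
        have := h _ rfl
        simp only [map_sub, aeval_X, map_one, sub_eq_zero] at this
        funext i
        simpa using this
      · rintro rfl
        simp [IsPoint]
  rw [torusClass, locClass_scissor _ _ (X () - 1), insert_empty_eq, h,
    threePointClass_eq_locClass, add_comm]

-- Remove the origin from the line.
variable (K) in
theorem lefschetzClass_eq : lefschetzClass K = torusClass K + 1 := by
  have h1 : IsCoordinateRing (∅ : Set (MvPolynomial (Fin 1) K)) 1 (MvPolynomial (Fin 1) K) X := by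
    refine ⟨⟨by simp, by simp⟩, fun x _ => ⟨aeval x, funext fun i => ?_⟩, fun φ ψ h => ?_⟩
    · rw [Function.comp_apply, aeval_X]
    · refine MvPolynomial.algHom_ext fun i => ?_
      have := congrFun h i
      rwa [Function.comp_apply, Function.comp_apply] at this
  have h2 : lefschetzClass K = specClass K (MvPolynomial (Fin 1) K) := rfl
  have h3 : locClass (∅ : Set (MvPolynomial (Fin 1) K)) 1 =
      locClass (∅ : Set (MvPolynomial Unit K)) 1 :=
    locClass_reindex (Equiv.ofUnique (Fin 1) Unit) fun x => by simp [IsPoint]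
  have h4 : locClass {(X () : MvPolynomial Unit K)} 1 = 1 :=
    locClass_eq_one 0 fun {R} _ _ x => by
      constructor
      · rintro ⟨h, -⟩
        have := h _ rfl
        rw [aeval_X] at this
        funext i
        simpa using this
      · rintro rfl
        simp [IsPoint]
  rw [h2, ← h1.locClass_eq, h3, locClass_scissor _ _ (X ()), insert_empty_eq, h4, one_mul,
    torusClass, add_comm]

theorem threePointClass_eq_lefschetzClass_sub_two (K : Type u) [Field K] :
    threePointClass K = lefschetzClass K - 2 := by
  rw [lefschetzClass_eq, torusClass_eq]
  ring

/-- The pairs of resistances that cancel in series without being zero, parametrized by the first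
one. -/
theorem locClass_antidiagonal :
    locClass {(X false + X true : MvPolynomial Bool K)} (X false * X true) = torusClass K := by
  refine locClass_eq_of_rel (fun x y => y () = x false) ?_ ?_ ?_ ?_ ?_
  · rintro R S _ _ _ _ φ x y h
    exact congrArg φ h
  · rintro R _ _ x ⟨-, h⟩
    rw [map_mul, aeval_X, aeval_X, IsUnit.mul_iff] at h
    exact ⟨fun _ => x false, ⟨by simp, by simpa using h.1⟩, rfl⟩
  · rintro R _ _ y ⟨-, h⟩
    rw [aeval_X] at h
    exact ⟨fun b => if b then - y () else y (), ⟨by simp, by simpa using h⟩, rfl⟩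
  · rintro R _ _ x y y' - - - h h'
    funext i
    exact h.trans h'.symm
  · rintro R _ _ x x' y ⟨hx, -⟩ ⟨hx', -⟩ - h h'
    have e := hx _ rfl
    have e' := hx' _ rfl
    rw [map_add, aeval_X, aeval_X] at e e'
    have h0 : x false = x' false := h.symm.trans h'
    funext b
    cases b
    · exact h0
    · linear_combination e - e' - h0

/-- The pairs of invertible resistances with sum one. The first coordinate must avoid `0` and `1`,
and this is how `𝕊` enters the classes of networks. -/
theorem locClass_antidiagonal_one :
    locClass {(X false + X true - 1 : MvPolynomial Bool K)} (X false * X true) =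
      threePointClass K := by
  rw [threePointClass_eq_locClass]
  refine locClass_eq_of_rel (fun x y => y () = x false) ?_ ?_ ?_ ?_ ?_
  · rintro R S _ _ _ _ φ x y h
    exact congrArg φ h
  · rintro R _ _ x ⟨e, h⟩
    have e := e _ rfl
    simp only [map_mul, map_add, map_sub, map_one, aeval_X, IsUnit.mul_iff] at h e
    refine ⟨fun _ => x false, ⟨by simp, ?_⟩, rfl⟩
    simp only [map_mul, map_sub, map_one, aeval_X, IsUnit.mul_iff]
    refine ⟨h.1, ?_⟩
    rw [show x false - 1 = - x true by linear_combination e]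
    exact h.2.neg
  · rintro R _ _ y ⟨-, h⟩
    simp only [map_mul, map_sub, map_one, aeval_X, IsUnit.mul_iff] at h
    refine ⟨fun b => if b then 1 - y () else y (), ⟨by simp, ?_⟩, rfl⟩
    simp only [map_mul, aeval_X, IsUnit.mul_iff]
    refine ⟨by simpa using h.1, ?_⟩
    rw [if_pos trivial, ← neg_sub]
    exact h.2.neg
  · rintro R _ _ x y y' - - - h h'
    funext i
    exact h.trans h'.symm
  · rintro R _ _ x x' y ⟨hx, -⟩ ⟨hx', -⟩ - h h'
    have e := hx _ rfl
    have e' := hx' _ rfl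
    simp only [map_add, map_sub, map_one, aeval_X] at e e'
    have h0 : x false = x' false := h.symm.trans h'
    funext b
    cases b
    · exact h0
    · linear_combination e - e' - h0

variable (K) in
/-- The classes that are polynomials in `𝕊` with nonnegative integer coefficients. -/
noncomputable def posClasses : Subsemiring (GrothendieckRing K) :=
  Subsemiring.closure {threePointClass K}

theorem exists_polynomial_of_mem_posClasses {c : GrothendieckRing K} (hc : c ∈ posClasses K) :
    ∃ P : Polynomial ℤ, (∀ i, 0 ≤ P.coeff i) ∧ c = Polynomial.aeval (threePointClass K) P := by
  induction hc using Subsemiring.closure_induction with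
  | mem x hx =>
    obtain rfl := hx
    refine ⟨Polynomial.X, fun i => ?_, by simp⟩
    rw [Polynomial.coeff_X]
    split_ifs <;> simp
  | zero => exact ⟨0, by simp, by simp⟩
  | one =>
    refine ⟨1, fun i => ?_, by simp⟩
    rw [Polynomial.coeff_one]
    split_ifs <;> simp
  | add x y _ _ hx hy =>
    obtain ⟨P, hP, rfl⟩ := hx
    obtain ⟨Q, hQ, rfl⟩ := hy
    exact ⟨P + Q, fun i => by rw [Polynomial.coeff_add]; exact add_nonneg (hP i) (hQ i), by simp⟩
  | mul x y _ _ hx hy =>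
    obtain ⟨P, hP, rfl⟩ := hx
    obtain ⟨Q, hQ, rfl⟩ := hy
    refine ⟨P * Q, fun i => ?_, by simp⟩
    rw [Polynomial.coeff_mul]
    exact Finset.sum_nonneg fun p _ => mul_nonneg (hP _) (hQ _)

theorem threePointClass_mem_posClasses : threePointClass K ∈ posClasses K :=
  Subsemiring.subset_closure rfl

theorem torusClass_mem_posClasses : torusClass K ∈ posClasses K := by
  rw [torusClass_eq]
  exact add_mem threePointClass_mem_posClasses (one_mem _)

end lefschetz

/-! ### Rescaling networks and product decompositions -/

section network

open MvPolynomial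

variable {K : Type u} [Field K] {ι ι₁ ι₂ : Type}

/-- Rescaling the coordinates by `r ^ w` rescales `B / A` by `r`. -/
def IsScaling (w : ℤ) (A B : MvPolynomial ι K) : Prop :=
  ∀ {R : Type u} [CommRing R] [Algebra K R] (r : Rˣ) (x : ι → R), ∃ c : Rˣ,
    aeval (((r ^ w : Rˣ) : R) • x) A = c * aeval x A ∧
    aeval (((r ^ w : Rˣ) : R) • x) B = r * c * aeval x B

/-- Multiplying `A / B` by `r` means multiplying `B / A` by `r⁻¹`, so the exponent changes sign. -/
theorem IsScaling.swap {w : ℤ} {A B : MvPolynomial ι K} (h : IsScaling w A B) :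
    IsScaling (-w) B A := by
  intro R _ _ r x
  obtain ⟨c, h1, h2⟩ := h r⁻¹ x
  refine ⟨r⁻¹ * c, ?_, ?_⟩
  · rw [zpow_neg, ← inv_zpow, h2]
    push_cast
    ring
  · rw [zpow_neg, ← inv_zpow, h1]
    push_cast
    rw [Units.mul_inv_cancel_left]

/-- If `x = r ^ w y` with `A(y) = B(y)` a unit then `r = B(x) / A(x)`. -/
theorem IsScaling.exists_eq_smul {w : ℤ} {A B : MvPolynomial ι K} (h : IsScaling w A B)
    {R : Type u} [CommRing R] [Algebra K R] {x : ι → R} (hA : IsUnit (aeval x A))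
    (hB : IsUnit (aeval x B)) : ∃ (r : Rˣ) (y : ι → R), aeval x B = r * aeval x A ∧
      x = ((r ^ w : Rˣ) : R) • y ∧ IsPoint {A - B} (A * B) y := by
  obtain ⟨a, ha⟩ := hA
  obtain ⟨b, hb⟩ := hB
  -- Rescaling by the inverse of the current ratio `b / a` makes the two polynomials equal.
  obtain ⟨c, h1, h2⟩ := h (b * a⁻¹)⁻¹ x
  have hu : IsUnit ((c : R) * aeval x A) := c.isUnit.mul (ha ▸ a.isUnit)
  have he : (((b * a⁻¹)⁻¹ : Rˣ) : R) * c * aeval x B = c * aeval x A := by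
    have : (b * a⁻¹)⁻¹ * c * b = c * a := by
      rw [mul_inv_rev, inv_inv]
      calc a * b⁻¹ * c * b = c * a * (b⁻¹ * b) := by ac_rfl
        _ = c * a := by rw [inv_mul_cancel, mul_one]
    rw [← ha, ← hb]
    exact_mod_cast congrArg Units.val this
  refine ⟨b * a⁻¹, (((b * a⁻¹)⁻¹ ^ w : Rˣ) : R) • x, ?_, ?_, ?_, ?_⟩
  · rw [← ha, ← hb]
    norm_cast
    rw [inv_mul_cancel_right]
  · rw [smul_smul, inv_zpow, Units.mul_inv, one_smul]
  · rintro _ rfl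
    rw [map_sub, h1, h2, he, sub_self]
  · rw [map_mul, h1, h2, he]
    exact hu.mul hu

/-- Conversely, rescaling a point of resistance one produces the resistance `r`. -/
theorem IsPoint.aeval_smul {w : ℤ} {A B : MvPolynomial ι K} (h : IsScaling w A B)
    {R : Type u} [CommRing R] [Algebra K R] {y : ι → R} (hy : IsPoint {A - B} (A * B) y) (r : Rˣ) :
    IsUnit (aeval (((r ^ w : Rˣ) : R) • y) A) ∧
      aeval (((r ^ w : Rˣ) : R) • y) B = r * aeval (((r ^ w : Rˣ) : R) • y) A := by
  obtain ⟨c, h1, h2⟩ := h r y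
  have h3 := hy.1 _ rfl
  have h4 := hy.2
  rw [map_sub, sub_eq_zero] at h3
  rw [map_mul, IsUnit.mul_iff] at h4
  rw [h1, h2, h3, mul_assoc]
  exact ⟨c.isUnit.mul h4.2, rfl⟩

variable [Finite ι] [Finite ι₁] [Finite ι₂]

/-- The locus where `A` and `B` do not vanish is a product, with `B / A` as one of the factors. -/
theorem locClass_mul_of_isScaling {w : ℤ} {A B : MvPolynomial ι K} (h : IsScaling w A B) :
    locClass ∅ (A * B) = torusClass K * locClass {A - B} (A * B) := by
  rw [torusClass, ← locClass_mul (I := {rename Sum.inr (A - B)})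
    (g := rename Sum.inl (X ()) * rename Sum.inr (A * B))]
  swap
  · intro R _ _ x y
    simp [IsPoint, aeval_rename, and_left_comm]
  have hpt : ∀ {R : Type u} [CommRing R] [Algebra K R] (y : Unit ⊕ ι → R),
      IsPoint {rename Sum.inr (A - B)} (rename Sum.inl (X ()) * rename Sum.inr (A * B)) y ↔
        IsUnit (y (Sum.inl ())) ∧ IsPoint {A - B} (A * B) (y ∘ Sum.inr) := fun y => by
    simp [IsPoint, aeval_rename, and_left_comm]
  -- The correspondence is `x = r ^ w • y`, where `r = B(x) / A(x)` and `y` is the normalization of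
  -- `x` to resistance one. Since `A(x)` is invertible, `r` and then `y` are determined by `x`.
  refine locClass_eq_of_rel (fun {R} _ _ x y => ∃ r : Rˣ, y (Sum.inl ()) = r ∧
    x = ((r ^ w : Rˣ) : R) • (y ∘ Sum.inr)) ?_ ?_ ?_ ?_ ?_
  · rintro R S _ _ _ _ φ x y ⟨r, h1, h2⟩
    refine ⟨Units.map (φ : R →* S) r, ?_, ?_⟩
    · rw [Function.comp_apply, h1]
      rfl
    · rw [h2]
      funext i
      have : φ ((r ^ w : Rˣ) : R) = ((Units.map (φ : R →* S) r ^ w : Sˣ) : S) := by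
        rw [← map_zpow]
        rfl
      simp [this]
  · rintro R _ _ x ⟨-, hx⟩
    rw [map_mul, IsUnit.mul_iff] at hx
    obtain ⟨r, y, -, h2, h3⟩ := h.exists_eq_smul hx.1 hx.2
    exact ⟨Sum.elim (fun _ => r) y, (hpt _).2 ⟨r.isUnit, h3⟩, r, rfl, h2⟩
  · rintro R _ _ y hy
    obtain ⟨⟨r, hr⟩, h2⟩ := (hpt _).1 hy
    obtain ⟨h3, h4⟩ := h2.aeval_smul h r
    refine ⟨_, ⟨by simp, ?_⟩, r, hr.symm, rfl⟩
    rw [map_mul, h4]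
    exact h3.mul (r.isUnit.mul h3)
  · rintro R _ _ x y y' - hy hy' ⟨r, h1, h2⟩ ⟨r', h1', h2'⟩
    obtain ⟨h3, h4⟩ := ((hpt _).1 hy).2.aeval_smul h r
    obtain ⟨-, h4'⟩ := ((hpt _).1 hy').2.aeval_smul h r'
    rw [← h2] at h3 h4
    rw [← h2', h4] at h4'
    have hr : r = r' := Units.ext (h3.mul_right_cancel h4')
    subst hr
    rw [h2'] at h2
    have h5 := congrArg (fun z => ((r ^ w)⁻¹ : Rˣ) • z) h2
    funext i
    rcases i with i | i
    · exact h1.trans h1'.symm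
    · have := congrFun h5 i
      simpa [Units.smul_def] using this.symm
  · rintro R _ _ x x' y - - - ⟨r, h1, h2⟩ ⟨r', h1', h2'⟩
    have hr : r = r' := Units.ext (h1.symm.trans h1')
    rw [h2, h2', hr]

/-- A locus in the variables of two networks that forces both resistances to be invertible, and
otherwise depends on the resistances alone, is a product. One factor is the locus in `𝔾ₘ²` of
admissible pairs of resistances, cut out by `J` and `k`, with coordinate `false` for the first
network and `true` for the second; the others are the two resistance-one loci. -/
theorem locClass_mul_mul_of_isScaling {w : ℤ} {A₁ B₁ : MvPolynomial ι₁ K}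
    {A₂ B₂ : MvPolynomial ι₂ K} (h₁ : IsScaling w A₁ B₁) (h₂ : IsScaling w A₂ B₂)
    {I : Set (MvPolynomial (ι₁ ⊕ ι₂) K)} {g : MvPolynomial (ι₁ ⊕ ι₂) K}
    {J : Set (MvPolynomial Bool K)} {k : MvPolynomial Bool K}
    (hunit : ∀ {R : Type u} [CommRing R] [Algebra K R] (x₁ : ι₁ → R) (x₂ : ι₂ → R),
      IsPoint I g (Sum.elim x₁ x₂) → (IsUnit (aeval x₁ A₁) ∧ IsUnit (aeval x₁ B₁)) ∧
        IsUnit (aeval x₂ A₂) ∧ IsUnit (aeval x₂ B₂))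
    (hJ : ∀ {R : Type u} [CommRing R] [Algebra K R] (x₁ : ι₁ → R) (x₂ : ι₂ → R) (r : Bool → Rˣ),
      IsUnit (aeval x₁ A₁) → IsUnit (aeval x₂ A₂) → aeval x₁ B₁ = r false * aeval x₁ A₁ →
        aeval x₂ B₂ = r true * aeval x₂ A₂ →
          (IsPoint I g (Sum.elim x₁ x₂) ↔ IsPoint J k fun b => (r b : R)))
    (hk : ∀ {R : Type u} [CommRing R] [Algebra K R] (y : Bool → R), IsPoint J k y →
      ∀ b, IsUnit (y b)) :
    locClass I g =
      locClass J k * (locClass {A₁ - B₁} (A₁ * B₁) * locClass {A₂ - B₂} (A₂ * B₂)) := by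
  rw [← locClass_mul (I := {rename Sum.inl (A₁ - B₁), rename Sum.inr (A₂ - B₂)})
    (g := rename Sum.inl (A₁ * B₁) * rename Sum.inr (A₂ * B₂)),
    ← locClass_mul (I := rename Sum.inl '' J ∪
      rename Sum.inr '' {rename Sum.inl (A₁ - B₁), rename Sum.inr (A₂ - B₂)})
      (g := rename Sum.inl k * rename Sum.inr (rename Sum.inl (A₁ * B₁) *
        rename Sum.inr (A₂ * B₂)))]
  rotate_left
  · intro R _ _ x y
    simp only [IsPoint, Set.mem_union, or_imp, forall_and, Set.forall_mem_image, map_mul,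
      aeval_rename, Sum.elim_comp_inl, Sum.elim_comp_inr, IsUnit.mul_iff]
    tauto
  · intro R _ _ x y
    simp only [IsPoint, Set.mem_insert_iff, Set.mem_singleton_iff, forall_eq_or_imp, forall_eq,
      map_mul, aeval_rename, Sum.elim_comp_inl, Sum.elim_comp_inr, IsUnit.mul_iff]
    tauto
  set I' := rename Sum.inl '' J ∪
      rename Sum.inr '' {rename Sum.inl (A₁ - B₁), rename Sum.inr (A₂ - B₂)} with hI'
  set g' := rename Sum.inl k * rename Sum.inr (rename Sum.inl (A₁ * B₁) *
        rename Sum.inr (A₂ * B₂)) with hg'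
  have hpt : ∀ {R : Type u} [CommRing R] [Algebra K R] (y : Bool ⊕ (ι₁ ⊕ ι₂) → R),
      IsPoint I' g' y ↔ IsPoint J k (y ∘ Sum.inl) ∧
        IsPoint {A₁ - B₁} (A₁ * B₁) (y ∘ Sum.inr ∘ Sum.inl) ∧
        IsPoint {A₂ - B₂} (A₂ * B₂) (y ∘ Sum.inr ∘ Sum.inr) := fun y => by
    simp only [IsPoint, Set.mem_union, or_imp, forall_and, Set.forall_mem_image, map_mul,
      aeval_rename, IsUnit.mul_iff, Set.mem_insert_iff, Set.mem_singleton_iff,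
      forall_eq, hI', hg', Function.comp_assoc]
    tauto
  -- Each network is normalized to resistance one separately, and the two ratios are kept as
  -- coordinates.
  refine locClass_eq_of_rel (fun {R} _ _ x y => ∃ r : Bool → Rˣ, y ∘ Sum.inl = (fun b => (r b : R)) ∧
    x ∘ Sum.inl = ((r false ^ w : Rˣ) : R) • (y ∘ Sum.inr ∘ Sum.inl) ∧
    x ∘ Sum.inr = ((r true ^ w : Rˣ) : R) • (y ∘ Sum.inr ∘ Sum.inr)) ?_ ?_ ?_ ?_ ?_
  · rintro R S _ _ _ _ φ x y ⟨r, h1, h2, h3⟩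
    have key : ∀ b, φ ((r b ^ w : Rˣ) : R) = ((Units.map (φ : R →* S) (r b) ^ w : Sˣ) : S) := by
      intro b
      rw [← map_zpow]
      rfl
    refine ⟨fun b => Units.map (φ : R →* S) (r b), ?_, ?_, ?_⟩
    · funext b
      exact congrArg φ (congrFun h1 b)
    · funext i
      have := congrArg φ (congrFun h2 i)
      rw [Pi.smul_apply, smul_eq_mul, map_mul, key] at this
      exact this
    · funext i
      have := congrArg φ (congrFun h3 i)
      rw [Pi.smul_apply, smul_eq_mul, map_mul, key] at this
      exact this
  · rintro R _ _ x hx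
    obtain ⟨x₁, x₂, rfl⟩ : ∃ x₁ x₂, x = Sum.elim x₁ x₂ :=
      ⟨x ∘ Sum.inl, x ∘ Sum.inr, (Sum.elim_comp_inl_inr x).symm⟩
    obtain ⟨⟨hA₁, hB₁⟩, hA₂, hB₂⟩ := hunit _ _ hx
    obtain ⟨r₁, y₁, e₁, h2, h3⟩ := h₁.exists_eq_smul hA₁ hB₁
    obtain ⟨r₂, y₂, e₂, h2', h3'⟩ := h₂.exists_eq_smul hA₂ hB₂
    refine ⟨Sum.elim (fun b => ((cond b r₂ r₁ : Rˣ) : R)) (Sum.elim y₁ y₂),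
      (hpt _).2 ⟨?_, h3, h3'⟩, fun b => cond b r₂ r₁, rfl, h2, h2'⟩
    exact (hJ x₁ x₂ (fun b => cond b r₂ r₁) hA₁ hA₂ e₁ e₂).1 hx
  · rintro R _ _ y hy
    obtain ⟨h1, h2, h3⟩ := (hpt _).1 hy
    choose r hr using hk _ h1
    obtain ⟨h4, h5⟩ := h2.aeval_smul h₁ (r false)
    obtain ⟨h4', h5'⟩ := h3.aeval_smul h₂ (r true)
    refine ⟨Sum.elim _ _, (hJ _ _ r h4 h4' h5 h5').2 ?_, r, funext fun b => (hr b).symm, rfl, rfl⟩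
    simpa only [hr] using h1
  · rintro R _ _ x y y' - hy hy' ⟨r, h1, h2, h3⟩ ⟨r', h1', h2', h3'⟩
    obtain ⟨-, g1, g2⟩ := (hpt _).1 hy
    obtain ⟨-, g1', g2'⟩ := (hpt _).1 hy'
    obtain ⟨e1, e2⟩ := g1.aeval_smul h₁ (r false)
    obtain ⟨-, e2'⟩ := g1'.aeval_smul h₁ (r' false)
    obtain ⟨f1, f2⟩ := g2.aeval_smul h₂ (r true)
    obtain ⟨-, f2'⟩ := g2'.aeval_smul h₂ (r' true)
    rw [← h2] at e1 e2
    rw [← h2', e2] at e2'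
    rw [← h3] at f1 f2
    rw [← h3', f2] at f2'
    obtain rfl : r = r' := by
      funext b
      cases b
      · exact Units.ext (e1.mul_right_cancel e2')
      · exact Units.ext (f1.mul_right_cancel f2')
    rw [h2'] at h2
    rw [h3'] at h3
    have h5 := congrArg (fun z => ((r false ^ w)⁻¹ : Rˣ) • z) h2
    have h6 := congrArg (fun z => ((r true ^ w)⁻¹ : Rˣ) • z) h3
    funext i
    rcases i with i | i | i
    · exact congrFun (h1.trans h1'.symm) i
    · have := congrFun h5 i
      simpa [Units.smul_def] using this.symm
    · have := congrFun h6 i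
      simpa [Units.smul_def] using this.symm
  · rintro R _ _ x x' y - - - ⟨r, h1, h2, h3⟩ ⟨r', h1', h2', h3'⟩
    obtain rfl : r = r' := funext fun b => Units.ext (congrFun (h1.symm.trans h1') b)
    funext i
    rcases i with i | i
    · exact congrFun (h2.trans h2'.symm) i
    · exact congrFun (h3.trans h3'.symm) i

end network

/-! ### Positive pairs and series composition -/

section network

open MvPolynomial

variable {K : Type u} [Field K] {ι ι' ι₁ ι₂ : Type} [Finite ι] [Finite ι'] [Finite ι₁] [Finite ι₂]

/-- The pair of polynomials `(A, B)` of a two-terminal network for which the classes of the loci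
`B = 0 ≠ A`, `A = 0 ≠ B` and `A = B ≠ 0` are polynomials in `𝕊` with nonnegative coefficients. -/
structure IsPositivePair (w : ℤ) (A B : MvPolynomial ι K) : Prop where
  scaling : IsScaling w A B
  zero : locClass {B} A ∈ posClasses K
  infty : locClass {A} B ∈ posClasses K
  one : locClass {A - B} (A * B) ∈ posClasses K

namespace IsPositivePair

/-- The duality of series and parallel composition: it exchanges resistance zero and infinity and
preserves resistance one. Parallel composition is series composition between two swaps. -/
theorem swap {w : ℤ} {A B : MvPolynomial ι K} (h : IsPositivePair w A B) :
    IsPositivePair (-w) B A where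
  scaling := IsScaling.swap h.scaling
  zero := h.infty
  infty := h.zero
  one := by
    convert h.one using 1
    refine locClass_congr fun x => ?_
    simp only [IsPoint, Set.mem_singleton_iff, forall_eq, map_sub, mul_comm B A, sub_eq_zero]
    rw [eq_comm]

theorem isUnit_mem {w : ℤ} {A B : MvPolynomial ι K} (h : IsPositivePair w A B) :
    locClass ∅ (A * B) ∈ posClasses K := by
  rw [locClass_mul_of_isScaling h.scaling]
  exact mul_mem torusClass_mem_posClasses h.one

/-- Where `A` is invertible, the resistance is finite: it is zero, or it is invertible and the
scaling applies. -/
theorem left_mem {w : ℤ} {A B : MvPolynomial ι K} (h : IsPositivePair w A B) :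
    locClass ∅ A ∈ posClasses K := by
  rw [locClass_scissor _ _ B, insert_empty_eq]
  exact add_mem h.zero h.isUnit_mem

/-- The resistance is the variable itself, so resistance zero and one are single points, and
infinity does not occur. -/
theorem edge : IsPositivePair 1 (1 : MvPolynomial Unit K) (X ()) where
  scaling r x := ⟨1, by simp, by simp⟩
  zero := by
    rw [locClass_eq_one 0 fun {R} _ _ x => ?_]
    · exact one_mem _
    · simp only [IsPoint, Set.mem_singleton_iff, forall_eq, map_one, isUnit_one, and_true, aeval_X]
      constructor
      · intro h
        funext i
        simpa using h
      · rintro rfl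
        simp
  infty := by
    rw [locClass_eq_zero fun {R} _ _ x h => ?_]
    · exact zero_mem _
    · simpa using h.1 _ rfl
  one := by
    rw [locClass_eq_one 1 fun {R} _ _ x => ?_]
    · exact one_mem _
    · simp only [IsPoint, Set.mem_singleton_iff, forall_eq, map_sub, map_one, aeval_X, sub_eq_zero,
        one_mul]
      constructor
      · rintro ⟨h, -⟩
        funext i
        simpa using h.symm
      · rintro rfl
        simp

/-- The neutral element for series composition, which starts the induction over strings. Having no
variables, it scales with every weight. -/
theorem shortCircuit (w : ℤ) [IsEmpty ι] : IsPositivePair w (1 : MvPolynomial ι K) 0 where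
  scaling r x := ⟨1, by simp, by simp⟩
  zero := by
    rw [locClass_eq_one isEmptyElim fun {R} _ _ x => ?_]
    · exact one_mem _
    · simp [IsPoint, funext_iff]
  infty := by
    rw [locClass_eq_zero fun {R} _ _ x h => ?_]
    · exact zero_mem _
    · simpa using h.1 _ rfl
  one := by
    rw [locClass_eq_zero fun {R} _ _ x h => ?_]
    · exact zero_mem _
    · simpa using h.1 _ rfl

theorem reindex {w : ℤ} {A B : MvPolynomial ι K} (h : IsPositivePair w A B) (σ : ι ≃ ι') :
    IsPositivePair w (rename σ A) (rename σ B) := by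
  have key : ∀ P Q : MvPolynomial ι K, locClass {rename σ P} (rename σ Q) = locClass {P} Q :=
    fun P Q => (locClass_reindex σ fun x => by simp [IsPoint, aeval_rename]).symm
  refine ⟨fun r x => ?_, ?_, ?_, ?_⟩
  · obtain ⟨c, h1, h2⟩ := h.scaling r (x ∘ σ)
    refine ⟨c, ?_, ?_⟩
    · rw [aeval_rename, aeval_rename]
      exact h1
    · rw [aeval_rename, aeval_rename]
      exact h2
  · rw [key]; exact h.zero
  · rw [key]; exact h.infty
  · rw [← map_sub, ← map_mul, key]; exact h.one

section series

variable {w : ℤ} {A₁ B₁ : MvPolynomial ι₁ K} {A₂ B₂ : MvPolynomial ι₂ K}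

/-- In series the resistances add, `r = r₁ + r₂`, so each locus splits according to `r₁` and `r₂`
into products of loci of the two networks. -/
theorem series (h₁ : IsPositivePair w A₁ B₁) (h₂ : IsPositivePair w A₂ B₂) :
    IsPositivePair w (rename Sum.inl A₁ * rename Sum.inr A₂ : MvPolynomial (ι₁ ⊕ ι₂) K)
      (rename Sum.inl A₁ * rename Sum.inr B₂ + rename Sum.inl B₁ * rename Sum.inr A₂) where
  scaling {R} _ _ r x := by
    obtain ⟨c₁, h1, h2⟩ := h₁.scaling r (x ∘ Sum.inl)
    obtain ⟨c₂, h3, h4⟩ := h₂.scaling r (x ∘ Sum.inr)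
    have hl : (((r ^ w : Rˣ) : R) • x) ∘ Sum.inl = ((r ^ w : Rˣ) : R) • (x ∘ Sum.inl) := rfl
    have hr : (((r ^ w : Rˣ) : R) • x) ∘ Sum.inr = ((r ^ w : Rˣ) : R) • (x ∘ Sum.inr) := rfl
    refine ⟨c₁ * c₂, ?_, ?_⟩
    · simp only [map_mul, aeval_rename, hl, hr, h1, h3]
      push_cast
      ring
    · simp only [map_mul, map_add, aeval_rename, hl, hr, h1, h2, h3, h4]
      push_cast
      ring
  zero := by
    -- `r₁ + r₂ = 0`: both resistances are zero, or `r₁` is invertible and `r₂ = -r₁`.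
    rw [locClass_scissor _ _ (rename Sum.inl B₁)]
    refine add_mem ?_ ?_
    · rw [locClass_mul (I₁ := {B₁}) (g₁ := A₁) (I₂ := {B₂}) (g₂ := A₂)]
      · exact mul_mem h₁.zero h₂.zero
      intro R _ _ x y
      simp only [IsPoint, Set.mem_insert_iff, Set.mem_singleton_iff, forall_eq_or_imp, forall_eq,
        map_mul, map_add, aeval_rename, Sum.elim_comp_inl, Sum.elim_comp_inr, IsUnit.mul_iff]
      constructor
      · rintro ⟨⟨h1, h2⟩, h3, h4⟩
        rw [h1, zero_mul, add_zero, h3.mul_right_eq_zero] at h2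
        exact ⟨⟨h1, h3⟩, h2, h4⟩
      · rintro ⟨⟨h1, h3⟩, h2, h4⟩
        exact ⟨⟨h1, by rw [h1, h2]; ring⟩, h3, h4⟩
    · rw [locClass_mul_mul_of_isScaling h₁.scaling h₂.scaling
        (J := {(X false + X true : MvPolynomial Bool K)}) (k := X false * X true),
        locClass_antidiagonal]
      · exact mul_mem torusClass_mem_posClasses (mul_mem h₁.one h₂.one)
      · intro R _ _ x y
        simp only [IsPoint, Set.mem_singleton_iff, forall_eq, map_mul, map_add, aeval_rename,
          Sum.elim_comp_inl, Sum.elim_comp_inr, IsUnit.mul_iff]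
        rintro ⟨h1, ⟨h2, h3⟩, h4⟩
        refine ⟨⟨h2, h4⟩, h3, ?_⟩
        have : IsUnit (aeval x A₁ * aeval y B₂) := by
          rw [eq_neg_of_add_eq_zero_left h1]
          exact (h4.mul h3).neg
        exact (IsUnit.mul_iff.1 this).2
      · intro R _ _ x y r h1 h2 h3 h4
        simp only [IsPoint, Set.mem_singleton_iff, forall_eq, map_mul, map_add, aeval_rename,
          Sum.elim_comp_inl, Sum.elim_comp_inr, IsUnit.mul_iff, aeval_X, h3, h4]
        have e : aeval x A₁ * ((r true : R) * aeval y A₂) + r false * aeval x A₁ * aeval y A₂ =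
            (aeval x A₁ * aeval y A₂) * (r false + r true) := by ring
        rw [e, (h1.mul h2).mul_right_eq_zero]
        simp [h1, h2]
      · intro R _ _ y hy
        have := hy.2
        simp only [map_mul, aeval_X, IsUnit.mul_iff] at this
        exact Bool.rec this.1 this.2
  infty := by
    -- `r₁ + r₂ = ∞`: exactly one of the resistances is infinite. If `A₁` and `A₂` both vanish, so
    -- does `A₁B₂ + B₁A₂`, which is excluded here.
    rw [locClass_scissor _ _ (rename Sum.inl A₁)]
    refine add_mem ?_ ?_
    · rw [locClass_mul (I₁ := {A₁}) (g₁ := B₁) (I₂ := ∅) (g₂ := A₂)]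
      · exact mul_mem h₁.infty h₂.left_mem
      intro R _ _ x y
      simp only [IsPoint, Set.mem_insert_iff, Set.mem_singleton_iff, forall_eq_or_imp, forall_eq,
        map_mul, map_add, aeval_rename, Sum.elim_comp_inl, Sum.elim_comp_inr,
        Set.mem_empty_iff_false, false_imp_iff, implies_true, true_and]
      constructor
      · rintro ⟨⟨h1, -⟩, h2⟩
        rw [h1, zero_mul, zero_add, IsUnit.mul_iff] at h2
        exact ⟨⟨h1, h2.1⟩, h2.2⟩
      · rintro ⟨⟨h1, h2⟩, h3⟩
        refine ⟨⟨h1, by rw [h1, zero_mul]⟩, ?_⟩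
        rw [h1, zero_mul, zero_add]
        exact h2.mul h3
    · rw [locClass_mul (I₁ := ∅) (g₁ := A₁) (I₂ := {A₂}) (g₂ := B₂)]
      · exact mul_mem h₁.left_mem h₂.infty
      intro R _ _ x y
      simp only [IsPoint, Set.mem_singleton_iff, forall_eq,
        map_mul, map_add, aeval_rename, Sum.elim_comp_inl, Sum.elim_comp_inr, IsUnit.mul_iff,
        Set.mem_empty_iff_false, false_imp_iff, implies_true, true_and]
      constructor
      · rintro ⟨h1, h2, h3⟩
        rw [h3.mul_right_eq_zero] at h1
        rw [h1, mul_zero, add_zero, IsUnit.mul_iff] at h2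
        exact ⟨h3, h1, h2.2⟩
      · rintro ⟨h1, h2, h3⟩
        rw [h2, mul_zero, mul_zero, add_zero]
        exact ⟨rfl, h1.mul h3, h1⟩
  one := by
    -- `r₁ + r₂ = 1`: the case `r₁ = 0`, `r₂ = 1` is separated first.
    rw [locClass_scissor _ _ (rename Sum.inl B₁)]
    refine add_mem ?_ ?_
    · rw [locClass_mul (I₁ := {B₁}) (g₁ := A₁) (I₂ := {A₂ - B₂}) (g₂ := A₂ * B₂)]
      · exact mul_mem h₁.zero h₂.one
      intro R _ _ x y
      simp only [IsPoint, Set.mem_insert_iff, Set.mem_singleton_iff, forall_eq_or_imp, forall_eq,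
        map_mul, map_add, map_sub, aeval_rename, Sum.elim_comp_inl, Sum.elim_comp_inr]
      constructor
      · rintro ⟨⟨h1, h2⟩, h3⟩
        rw [h1, zero_mul, add_zero] at h2 h3
        simp only [IsUnit.mul_iff] at h3
        rw [← mul_sub, h3.1.1.mul_right_eq_zero] at h2
        exact ⟨⟨h1, h3.1.1⟩, h2, h3.1.2.mul h3.2.2⟩
      · rintro ⟨⟨h1, h2⟩, h3, h4⟩
        rw [h1, zero_mul, add_zero, ← mul_sub, h3, mul_zero]
        rw [IsUnit.mul_iff] at h4
        exact ⟨⟨rfl, rfl⟩, (h2.mul h4.1).mul (h2.mul h4.2)⟩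
    -- With `r₁` invertible, either `r₂ = 0` and `r₁ = 1`, or both are invertible with sum one,
    -- which contributes the factor `𝕊`.
    rw [locClass_scissor _ _ (rename Sum.inr B₂)]
    refine add_mem ?_ ?_
    · rw [locClass_mul (I₁ := {A₁ - B₁}) (g₁ := A₁ * B₁) (I₂ := {B₂}) (g₂ := A₂)]
      · exact mul_mem h₁.one h₂.zero
      intro R _ _ x y
      simp only [IsPoint, Set.mem_insert_iff, Set.mem_singleton_iff, forall_eq_or_imp, forall_eq,
        map_mul, map_add, map_sub, aeval_rename, Sum.elim_comp_inl, Sum.elim_comp_inr]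
      constructor
      · rintro ⟨⟨h1, h2⟩, h3⟩
        rw [h1, mul_zero, zero_add] at h2 h3
        simp only [IsUnit.mul_iff] at h3
        rw [← sub_mul, h3.1.1.2.mul_left_eq_zero] at h2
        exact ⟨⟨h2, h3.1.1.1.mul h3.2⟩, h1, h3.1.1.2⟩
      · rintro ⟨⟨h1, h2⟩, h3, h4⟩
        rw [h3, mul_zero, zero_add, ← sub_mul, h1, zero_mul]
        rw [IsUnit.mul_iff] at h2
        exact ⟨⟨rfl, rfl⟩, ((h2.1.mul h4).mul (h2.2.mul h4)).mul h2.2⟩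
    · rw [locClass_mul_mul_of_isScaling h₁.scaling h₂.scaling
        (J := {(X false + X true - 1 : MvPolynomial Bool K)}) (k := X false * X true),
        locClass_antidiagonal_one]
      · exact mul_mem threePointClass_mem_posClasses (mul_mem h₁.one h₂.one)
      · intro R _ _ x y
        simp only [IsPoint, Set.mem_singleton_iff, forall_eq, map_mul, map_add, aeval_rename,
          Sum.elim_comp_inl, Sum.elim_comp_inr, IsUnit.mul_iff]
        rintro ⟨-, ⟨⟨⟨h1, h2⟩, -⟩, h3⟩, h4⟩
        exact ⟨⟨h1, h3⟩, h2, h4⟩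
      · intro R _ _ x y r h1 h2 h3 h4
        have e : aeval x A₁ * ((r true : R) * aeval y A₂) + r false * aeval x A₁ * aeval y A₂ =
            (aeval x A₁ * aeval y A₂) * (r false + r true) := by ring
        simp only [IsPoint, Set.mem_singleton_iff, forall_eq, map_mul, map_add, map_sub, map_one,
          aeval_rename, Sum.elim_comp_inl, Sum.elim_comp_inr, aeval_X, h3, h4, e]
        have e' : aeval x A₁ * aeval y A₂ - aeval x A₁ * aeval y A₂ * ((r false : R) + r true) =
            -(aeval x A₁ * aeval y A₂) * (r false + r true - 1) := by ring
        rw [e', (h1.mul h2).neg.mul_right_eq_zero]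
        -- Once `r₁ + r₂ = 1`, the two polynomials of the composite agree with `A₁A₂`, and
        -- invertibility only concerns `r₁` and `r₂`.
        refine and_congr_right fun h => ?_
        rw [sub_eq_zero.1 h]
        simp [IsUnit.mul_iff, h1, h2]
      · intro R _ _ y hy
        have := hy.2
        simp only [map_mul, aeval_X, IsUnit.mul_iff] at this
        exact Bool.rec this.1 this.2

end series

end IsPositivePair

end network

/-! ### Networks in disjoint sets of variables and induction over the graph -/

section networkOn

open MvPolynomial

/-- `seriesSum` obeys the recursion of series composition, with `x` in the role of the `A`s and `y`
in the role of the `B`s. -/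
theorem seriesSum_insert {α R : Type*} [DecidableEq α] [CommSemiring R] (x y : α → R) {a : α}
    {J : Finset α} (ha : a ∉ J) :
    seriesSum x y (insert a J) = x a * seriesSum x y J + y a * ∏ j ∈ J, x j := by
  rw [seriesSum, Finset.sum_insert ha, Finset.erase_insert ha, add_comm, seriesSum, Finset.mul_sum]
  congr 1
  refine Finset.sum_congr rfl fun j hj => ?_
  have hja : a ≠ j := fun h => ha (h ▸ hj)
  rw [Finset.erase_insert_of_ne hja,
    Finset.prod_insert fun h => ha (Finset.mem_of_mem_erase h)]
  ring

variable {K : Type u} [Field K] {κ : Type} [Finite κ]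

/-- `(A, B)` is a positive pair of polynomials in the variables in `s`. -/
def IsPositivePairOn (w : ℤ) (s : Set κ) (A B : MvPolynomial κ K) : Prop :=
  ∃ A₀ B₀ : MvPolynomial s K, IsPositivePair w A₀ B₀ ∧ rename (↑) A₀ = A ∧ rename (↑) B₀ = B

namespace IsPositivePairOn

variable {w : ℤ} {s s₁ s₂ : Set κ} {A B A₁ B₁ A₂ B₂ : MvPolynomial κ K}

theorem swap (h : IsPositivePairOn w s A B) : IsPositivePairOn (-w) s B A := by
  obtain ⟨A₀, B₀, h, hA, hB⟩ := h
  exact ⟨B₀, A₀, h.swap, hB, hA⟩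

theorem edge (k : κ) : IsPositivePairOn 1 {k} (1 : MvPolynomial κ K) (X k) :=
  ⟨_, _, IsPositivePair.edge.reindex (Equiv.ofUnique Unit ({k} : Set κ)), by simp,
    by rw [rename_X, rename_X]; rfl⟩

theorem shortCircuit (w : ℤ) : IsPositivePairOn w (∅ : Set κ) (1 : MvPolynomial κ K) 0 :=
  ⟨1, 0, .shortCircuit w, by simp, by simp⟩

theorem series (h₁ : IsPositivePairOn w s₁ A₁ B₁) (h₂ : IsPositivePairOn w s₂ A₂ B₂)
    (hs : Disjoint s₁ s₂) : IsPositivePairOn w (s₁ ∪ s₂) (A₁ * A₂) (A₁ * B₂ + B₁ * A₂) := by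
  classical
  obtain ⟨A₁, B₁, h₁, rfl, rfl⟩ := h₁
  obtain ⟨A₂, B₂, h₂, rfl, rfl⟩ := h₂
  set σ := (Equiv.Set.union hs).symm
  have hl : Subtype.val ∘ σ ∘ Sum.inl = (Subtype.val : s₁ → κ) := rfl
  have hr : Subtype.val ∘ σ ∘ Sum.inr = (Subtype.val : s₂ → κ) := rfl
  refine ⟨_, _, (h₁.series h₂).reindex σ, ?_, ?_⟩
  · simp only [map_mul, rename_rename, hl, hr]
  · simp only [map_mul, map_add, rename_rename, hl, hr]

theorem finset_series {α : Type*} [DecidableEq α] {s : α → Set κ} {A B : α → MvPolynomial κ K}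
    (hs : Pairwise fun i j => Disjoint (s i) (s j))
    (h : ∀ j, IsPositivePairOn w (s j) (A j) (B j)) (J : Finset α) :
    IsPositivePairOn w (⋃ j ∈ J, s j) (∏ j ∈ J, A j) (seriesSum A B J) := by
  induction J using Finset.induction_on with
  | empty => simpa [seriesSum] using shortCircuit w
  | insert a J ha ih =>
    rw [Finset.prod_insert ha, seriesSum_insert _ _ ha, Finset.set_biUnion_insert]
    refine (h a).series ih ?_
    rw [Set.disjoint_iUnion₂_right]
    exact fun j hj => hs fun h => ha (h ▸ hj)

theorem fintype_series {α : Type*} [Fintype α] [DecidableEq α] {s : α → Set κ}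
    {A B : α → MvPolynomial κ K} (hs : Pairwise fun i j => Disjoint (s i) (s j))
    (h : ∀ j, IsPositivePairOn w (s j) (A j) (B j)) :
    IsPositivePairOn w (⋃ j, s j) (∏ j, A j) (seriesSum A B Finset.univ) := by
  simpa using finset_series hs h Finset.univ

theorem left_mem (h : IsPositivePairOn w Set.univ A B) : locClass ∅ A ∈ posClasses K := by
  obtain ⟨A, B, h, rfl, -⟩ := h
  have := h.left_mem
  rwa [locClass_reindex (I' := ∅) (g' := rename (↑) A) (Equiv.Set.univ κ) fun x => ?_] at this
  simp only [IsPoint, aeval_rename, Set.mem_empty_iff_false, false_imp_iff, implies_true, true_and]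
  rfl

end IsPositivePairOn

variable (K) in
/-- Replacing the edges of `G` by networks that give positive pairs of polynomials, in disjoint sets
of variables, yields a hypersurface complement with positive class. -/
def Multigraph.IsPositive (G : Multigraph) : Prop :=
  ∀ (κ : Type) [Finite κ] (s : G.E → Set κ) (A B : G.E → MvPolynomial κ K),
    (Pairwise fun e f => Disjoint (s e) (s f)) → ⋃ e, s e = Set.univ →
      (∀ e, IsPositivePairOn 1 (s e) (A e) (B e)) → locClass ∅ (G.treeSum A B) ∈ posClasses K

theorem Multigraph.isPositive_singleEdge : singleEdge.IsPositive K := by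
  intro κ _ s A B _ hs h
  rw [treeSum_singleEdge]
  have : s () = Set.univ := by
    rw [← hs]
    exact (Set.iUnion_const (ι := Unit) (s ())).symm
  exact (this ▸ h ()).left_mem

theorem Multigraph.IsPositive.of_isIsomorphic {G H : Multigraph} (hG : G.IsPositive K)
    (h : G.IsIsomorphic H) : H.IsPositive K := by
  obtain ⟨φ, ψ, h⟩ := h
  intro κ _ s A B hs hu hp
  rw [treeSum_of_iso φ ψ h]
  refine hG κ (s ∘ ψ) _ _ (fun e f hef => hs (ψ.injective.ne hef)) ?_ fun e => hp _
  rw [← hu]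
  exact ψ.surjective.iUnion_comp s

/-- The networks on the new edges are merged into a single network on `e`: parallel within each
banana, then in series along the string. Because positivity is demanded for all networks on the
edges, the hypothesis on `G` applies to the merged weights. -/
theorem Multigraph.IsPositive.bananify {G : Multigraph} (hG : G.IsPositive K) (e : G.E)
    {b : List ℕ} (hb : b ≠ []) : (G.bananify e b).IsPositive K := by
  classical
  intro κ _ s A B hs hu hp
  have hnew : ∀ j i j' i', (⟨j, i⟩ : Σ j : Fin b.length, Fin (b.get j)) ≠ ⟨j', i'⟩ →
      Disjoint (s (newEdge j i)) (s (newEdge j' i')) := fun j i j' i' hne =>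
    hs fun h => hne (Sum.inr_injective h)
  have hold : ∀ f f', f ≠ f' → Disjoint (s (oldEdge f)) (s (oldEdge f')) := fun f f' hne =>
    hs fun h => hne (Sum.inl_injective h)
  have holdnew : ∀ f j i, Disjoint (s (oldEdge f)) (s (newEdge j i)) := fun f j i =>
    hs Sum.inl_ne_inr
  -- A banana is a parallel composition, obtained from the series rule with weight `-1` for the
  -- swapped pairs and a final swap back to weight `1`.
  have hbanana : ∀ j, IsPositivePairOn 1 (⋃ i, s (newEdge j i))
      (seriesSum (B ∘ newEdge j) (A ∘ newEdge j) Finset.univ) (∏ i, B (newEdge j i)) := by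
    intro j
    have := (IsPositivePairOn.fintype_series (s := s ∘ newEdge j) (A := B ∘ newEdge j)
      (B := A ∘ newEdge j) (fun i i' hne => hnew _ _ _ _ (by simpa using hne))
      fun i => (hp (newEdge j i)).swap).swap
    rwa [neg_neg] at this
  have hstring := IsPositivePairOn.fintype_series (fun j j' hne =>
    Set.disjoint_iUnion_left.2 fun i => Set.disjoint_iUnion_right.2 fun i' =>
      hnew _ _ _ _ fun h => hne (congrArg Sigma.fst h)) hbanana
  -- The merged network on `e` owns the variables of all the new edges.
  set t : G.E → Set κ := fun f => if h : f ≠ e then s (oldEdge ⟨f, h⟩) else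
    ⋃ j, ⋃ i, s (newEdge j i) with ht
  have hte : t e = ⋃ j, ⋃ i, s (newEdge j i) := by simp [ht]
  have htf : ∀ f (h : f ≠ e), t f = s (oldEdge ⟨f, h⟩) := fun f h => by simp [ht, h]
  have hdisj : ∀ f, f ≠ e → Disjoint (t f) (t e) := by
    intro f hf
    rw [hte, htf f hf]
    simp only [Set.disjoint_iUnion_right]
    exact fun j i => holdnew _ _ _
  rw [treeSum_bananify hb A B
    (fun f => if h : f ≠ e then A (oldEdge ⟨f, h⟩) else
      ∏ j, seriesSum (B ∘ newEdge j) (A ∘ newEdge j) Finset.univ)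
    (fun f => if h : f ≠ e then B (oldEdge ⟨f, h⟩) else
      seriesSum (fun j => seriesSum (B ∘ newEdge j) (A ∘ newEdge j) Finset.univ)
        (fun j => ∏ i, B (newEdge j i)) Finset.univ)
    (fun f => by simp [f.2]) (fun f => by simp [f.2]) (by simp) (by simp)]
  refine hG κ t _ _ ?_ ?_ ?_
  · intro f f' hne
    by_cases hf : f = e
    · subst hf
      exact (hdisj f' hne.symm).symm
    by_cases hf' : f' = e
    · subst hf'
      exact hdisj f hne
    rw [htf f hf, htf f' hf']
    exact hold _ _ fun h => hne (congrArg Subtype.val h)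
  · refine Set.eq_univ_of_forall fun k => ?_
    obtain ⟨a, ha⟩ := Set.mem_iUnion.1 (hu ▸ Set.mem_univ k : k ∈ ⋃ a, s a)
    induction a using edge_cases with
    | old f =>
      refine Set.mem_iUnion.2 ⟨f.1, ?_⟩
      rw [htf f.1 f.2]
      exact ha
    | new j i =>
      refine Set.mem_iUnion.2 ⟨e, ?_⟩
      rw [hte]
      exact Set.mem_iUnion₂.2 ⟨j, i, ha⟩
  · intro f
    by_cases hf : f = e
    · subst hf
      simpa [hte] using hstring
    · simpa [htf f hf, hf] using hp (oldEdge ⟨f, hf⟩)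

theorem Builds.isPositive {T : List MelonicStep} {G : Multigraph} {ℓ : G.E → ℕ × ℕ}
    (h : Builds T G ℓ) (hT : ∀ t ∈ T, t.b ≠ []) : G.IsPositive K := by
  induction h with
  | start => exact Multigraph.isPositive_singleEdge
  | step T G ℓ _ t e _ ih =>
    exact (ih fun t' ht' => hT t' (List.mem_append_left _ ht')).bananify e
      (hT t (List.mem_append_right _ (List.mem_singleton_self t)))

/-- Every edge is taken as its own network, with the pair `(1, t_e)`, which turns the tree sum into
the Kirchhoff–Symanzik polynomial. -/
theorem Multigraph.IsPositive.grothendieckClass_mem {G : Multigraph} (h : G.IsPositive K) :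
    G.grothendieckClass K ∈ posClasses K := by
  rw [Multigraph.grothendieckClass, hypersurfaceComplement_eq_locClass,
    kirchhoffPolynomial_eq_treeSum]
  refine h G.E (fun e => {e}) _ _ (fun e f hef => Set.disjoint_singleton.2 hef)
    (Set.iUnion_of_singleton _) fun e => .edge e

end networkOn

theorem mainTheorem3 (K : Type u) [Field K] :
    threePointClass K = lefschetzClass K - 2 ∧
    ∀ G : Multigraph, G.IsMelonic →
      ∃ P : Polynomial ℤ, (∀ i, 0 ≤ P.coeff i) ∧
        G.grothendieckClass K = Polynomial.aeval (threePointClass K) P := by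
  refine ⟨threePointClass_eq_lefschetzClass_sub_two K, ?_⟩
  rintro G ⟨T, hT, H, ℓ, hH, hiso⟩
  exact exists_polynomial_of_mem_posClasses
    ((hH.isPositive fun t ht => (hT.bananas t ht).1).of_isIsomorphic hiso).grothendieckClass_mem
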